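/- For $n\in\mathbb N$ let the nodes be the points of a Poisson process of rate $1$ on the square $[0,\sqrt n]^2$, and let $r(u,v)$ be the Euclidean distance on the torus obtained by identifying opposite edges of the square (i.e. edge effects are ignored). Fix $c>0$. Two distinct nodes $u,v$ with $r(u,v)<\sqrt{c\log n}$ are joined by a local edge (they are local contacts of each other). Given the nodes, every pair $u,v$ with $r(u,v)>\sqrt{c\log n}$ is joined, independently of all other pairs, by a shortcut with probability $\min(a_n\,r(u,v)^{-2},1)$, where $a_n$ is such that (for all sufficiently large $n$) the expected number of shortcuts of a node is $1$. A message from a node $s$ to a node $t$ is routed as follows. It carries the location of $t$ and a radius $r$, initially $r=r(s,t)$. Let $x$ be the node currently holding the message. If $x$ has a direct link to $t$, it delivers the message. Otherwise, if $x$ has a shortcut to a node $y$ in the annulus $A(t,r)=\{y: r/4<r(y,t)\le r/2\}$, it forwards the message to such a node. Otherwise it forwards the message to a local contact that is closer to $t$ than $x$ (if there is none, the message is stuck and is never delivered). A node $y$ receiving the message replaces $r$ by $r/2$ if $r(y,t)\le r/2$ and leaves $r$ unchanged otherwise. If several nodes are admissible as the next one, the choice among them is arbitrary, but depends only on what $x$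 knows: its own location, the location of $t$, the radius $r$, and the locations of its local contacts and of its shortcut contacts. Then there is $c_0>0$ such that for every $c\ge c_0$ there is a constant $C>0$ such that, for every such choice of rules, the probability that for all pairs of nodes $s,t$ the message from $s$ reaches $t$ in at most $C\log^2 n$ hops tends to $1$ as $n\to\infty$. -/

import Mathlib

open Filter Topology MeasureTheory ProbabilityTheory
open scoped ENNReal NNReal

namespace SmallWorld

noncomputable section

open scoped Classical

/-- Locations in the plane. -/
abbrev Pt : Type := ℝ × ℝ

/-- Euclidean distance on the torus obtained by identifying opposite edges of a square of
side `L`. The norm on `AddCircle L` is the distance to the nearest multiple of `L`. -/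
def torusDist (L : ℝ) (x y : Pt) : ℝ :=
  √(‖((x.1 - y.1 : ℝ) : AddCircle L)‖ ^ 2 + ‖((x.2 - y.2 : ℝ) : AddCircle L)‖ ^ 2)

theorem torusDist_comm (L : ℝ) (x y : Pt) : torusDist L x y = torusDist L y x := by
  have h : ∀ a b : ℝ, ‖((a - b : ℝ) : AddCircle L)‖ = ‖((b - a : ℝ) : AddCircle L)‖ := by
    intro a b
    rw [← norm_neg, ← AddCircle.coe_neg, neg_sub]
  unfold torusDist
  rw [h x.1 y.1, h x.2 y.2]

/-! ### The Poisson process -/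

/-- Sample space of the node process: a number of points and a sequence of locations in the
unit square. -/
abbrev NodeSpace : Type := ℕ × (ℕ → unitInterval × unitInterval)

/-- The number of points is Poisson with mean `n`; independently of it, the locations are
independent and uniform on the unit square. -/
def nodeLaw (n : ℕ) : Measure NodeSpace :=
  (poissonMeasure (n : ℝ≥0)).prod (Measure.infinitePi fun _ : ℕ => volume)

/-- The unit-rate Poisson process on `[0, √n]²`: Poisson(`n`) many independent uniform points of
that square. -/
def nodeSet (n : ℕ) (ω : NodeSpace) : Finset Pt :=
  (Finset.range ω.1).image fun i => (√n * ((ω.2 i).1 : ℝ), √n * ((ω.2 i).2 : ℝ))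

/-! ### The random graph -/

/-- The radius `√(c log n)` of the local edges. -/
def localRadius (c : ℝ) (n : ℕ) : ℝ := √(c * Real.log n)

/-- Probability of a shortcut between nodes at `u` and `v`: it is `a r⁻² ∧ 1` if the distance `r`
exceeds the local radius; nodes that are closer are not joined by shortcuts. -/
def shortcutProb (c : ℝ) (n : ℕ) (a : ℝ) (u v : Pt) : ℝ :=
  if localRadius c n < torusDist √n u v then min (a / torusDist √n u v ^ 2) 1 else 0

/-- `shortcutProb` as a function of the unordered pair. -/
def pairProb (c : ℝ) (n : ℕ) (a : ℝ) : Sym2 Pt → ℝ :=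
  Sym2.lift ⟨shortcutProb c n a, fun u v => by simp only [shortcutProb, torusDist_comm _ u v]⟩

/-- Expected number of shortcuts from a node located at `x` to the points of the Poisson
process. -/
def expectedShortcuts (c : ℝ) (n : ℕ) (a : ℝ) (x : Pt) : ℝ≥0∞ :=
  ∫⁻ ω, ∑ v ∈ nodeSet n ω, ENNReal.ofReal (shortcutProb c n a x v) ∂(nodeLaw n)

/-- The unordered pairs of distinct nodes. -/
def nodePairs (V : Finset Pt) : Finset (Sym2 Pt) := V.sym2.filter fun e => ¬ e.IsDiag

/-- Given the node set `V`, the probability that `S` is the set of all shortcuts: distinct pairs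
of nodes are joined independently, the pair `e` with probability `pairProb c n a e`. -/
def shortcutWeight (c : ℝ) (n : ℕ) (a : ℝ) (V : Finset Pt) (S : Finset (Sym2 Pt)) : ℝ :=
  (∏ e ∈ S, pairProb c n a e) * ∏ e ∈ nodePairs V \ S, (1 - pairProb c n a e)

/-- Probability of an event `E` (a property of the node set and of the shortcut set) in the
small-world graph: average over the Poisson process of the conditional probability given the
node set. -/
def graphProb (c : ℝ) (n : ℕ) (a : ℝ) (E : Finset Pt → Finset (Sym2 Pt) → Prop) : ℝ≥0∞ :=
  ∫⁻ ω, ENNReal.ofReal (∑ S ∈ (nodePairs (nodeSet n ω)).powerset.filter (E (nodeSet n ω)),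
    shortcutWeight c n a (nodeSet n ω) S) ∂(nodeLaw n)

/-- Local contacts of `x`: the other nodes at distance less than `√(c log n)`. -/
def localContacts (c : ℝ) (n : ℕ) (V : Finset Pt) (x : Pt) : Finset Pt :=
  V.filter fun y => y ≠ x ∧ torusDist √n x y < localRadius c n

/-- The nodes joined to `x` by a shortcut. -/
def shortcutContacts (V : Finset Pt) (S : Finset (Sym2 Pt)) (x : Pt) : Finset Pt :=
  V.filter fun y => s(x, y) ∈ S

/-! ### The routing algorithm -/

/-- What a node holding the message knows: its own location, the location of the target and the
radius (both carried by the message), and the locations of its local and shortcut contacts. -/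
structure View where
  position : Pt
  target : Pt
  radius : ℝ
  locals : Finset Pt
  shortcuts : Finset Pt

/-- The shortcut contacts in the annulus `A(t, r) = C(t, r/2) \ C(t, r/4)`. -/
def View.annulusShortcuts (n : ℕ) (w : View) : Finset Pt :=
  w.shortcuts.filter fun y =>
    torusDist √n y w.target ≤ w.radius / 2 ∧ ¬ torusDist √n y w.target ≤ w.radius / 4

/-- The local contacts that are closer to the target than the node itself. -/
def View.closerLocals (n : ℕ) (w : View) : Finset Pt :=
  w.locals.filter fun y => torusDist √n y w.target < torusDist √n w.position w.target

/-- `next` is a version of the approximately greedy decentralised algorithm. It chooses the next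
holder of the message from the view of the current one: the target if it is a contact; otherwise
a shortcut contact in the annulus, if there is one; otherwise a local contact closer to the
target, if there is one; otherwise the message is stuck. All choices among several admissible
contacts are arbitrary. -/
def IsApproxGreedy (n : ℕ) (next : View → Pt) : Prop :=
  ∀ w : View,
    if w.target ∈ w.locals ∪ w.shortcuts then next w = w.target
    else if (w.annulusShortcuts n).Nonempty then next w ∈ w.annulusShortcuts n
    else if (w.closerLocals n).Nonempty then next w ∈ w.closerLocals n
    else next w = w.position

/-- One hop: the state is the location of the message together with the radius it carries. The
receiving node `y` halves the radius `r` if its distance from the target is at most `r / 2`. -/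
def hop (c : ℝ) (n : ℕ) (next : View → Pt) (V : Finset Pt) (S : Finset (Sym2 Pt)) (t : Pt)
    (p : Pt × ℝ) : Pt × ℝ :=
  let y := next ⟨p.1, t, p.2, localContacts c n V p.1, shortcutContacts V S p.1⟩
  (y, if torusDist √n y t ≤ p.2 / 2 then p.2 / 2 else p.2)

/-- The message sent from `s` to `t`, with initial radius `r(s, t)`, reaches `t` in at most `K`
hops. -/
def DeliveredWithin (c : ℝ) (n : ℕ) (next : View → Pt) (V : Finset Pt) (S : Finset (Sym2 Pt))
    (s t : Pt) (K : ℝ) : Prop :=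
  ∃ k : ℕ, (k : ℝ) ≤ K ∧ ((hop c n next V S t)^[k] (s, torusDist √n s t)).1 = t

end

end SmallWorld

/-! With high probability the nodes are spread evenly at every scale above the local radius R
(`WellSpread`). By Chernoff bounds for Poisson counts and a union bound over grid cells and discs,
this fails with probability at most 3/n (`nodeLaw_not_wellSpread_le`). On such a configuration three
things hold. Greedy local steps never get stuck. A disc of radius 8R has O(log n) nodes. A holder x
with r/2 < d(x,t) ≤ r and r > 8R has on average at least q of order 1/log n shortcuts into the
annulus: it contains about r² nodes, each joined to x with probability of order a/r², and the
normalisation forces a to be at least of order 1/log n (`one_le_of_expectedShortcuts_eq_one`).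

The core is `resample_late_le`, an argument by deferred decisions. Until delivery the message moves
strictly closer to t, so pairs inside {x} ∪ {nodes closer than x} involve no earlier holder: their
coins are still untossed, whatever has been seen. Tossing the coins from x to closer nodes, with
probability at least 1 - e^(-q) some annulus shortcut appears and r is halved, unless the message is
delivered; otherwise r does not grow. Hence r is a potential whose mean contracts by ρ = (1 +
e^(-q))/2 per hop. Lateness before the near zone r ≤ 8R means r > 1, so k hops fail with probability
at most r ρ^k, by Markov's inequality in inductive form. Once r ≤ 8R the delivery is deterministic
in O(log n) hops (`reachesWithin_near`).

Taking k of order log² n gives ρ^k ≤ n^(-4), which survives the factor √n and the union bound over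
the at most 16n² pairs (s,t). -/

namespace SmallWorld

/-! ### Geometry of the flat torus. -/

section Torus

theorem torusDist_nonneg (L : ℝ) (x y : Pt) : 0 ≤ torusDist L x y := Real.sqrt_nonneg _

theorem sqrt_add_sq_add_sq_le (a b c d : ℝ) :
    √((a + c) ^ 2 + (b + d) ^ 2) ≤ √(a ^ 2 + b ^ 2) + √(c ^ 2 + d ^ 2) := by
  have h := norm_add_le (⟨a, b⟩ : ℂ) ⟨c, d⟩
  simpa [Complex.norm_eq_sqrt_sq_add_sq] using h

theorem torusDist_triangle (L : ℝ) (x y z : Pt) :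
    torusDist L x z ≤ torusDist L x y + torusDist L y z := by
  have key : ∀ a b c : ℝ, ‖((a - c : ℝ) : AddCircle L)‖ ≤
      ‖((a - b : ℝ) : AddCircle L)‖ + ‖((b - c : ℝ) : AddCircle L)‖ := by
    intro a b c
    have : ((a - c : ℝ) : AddCircle L) =
        ((a - b : ℝ) : AddCircle L) + ((b - c : ℝ) : AddCircle L) := by
      rw [← AddCircle.coe_add]; congr 1; ring
    rw [this]
    exact norm_add_le _ _
  refine le_trans (Real.sqrt_le_sqrt ?_) (sqrt_add_sq_add_sq_le _ _ _ _)
  gcongr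
  · exact key _ _ _
  · exact key _ _ _

theorem norm_coe_le_abs (L x : ℝ) : ‖(x : AddCircle L)‖ ≤ |x| :=
  QuotientAddGroup.norm_mk_le_norm

theorem torusDist_le_of_abs_le {L s : ℝ} {x y : Pt} (h₁ : |x.1 - y.1| ≤ s)
    (h₂ : |x.2 - y.2| ≤ s) : torusDist L x y ≤ 2 * s := by
  have hs : 0 ≤ s := (abs_nonneg _).trans h₁
  refine Real.sqrt_le_iff.2 ⟨by positivity, ?_⟩
  have a₁ := (norm_coe_le_abs L (x.1 - y.1)).trans h₁
  have a₂ := (norm_coe_le_abs L (x.2 - y.2)).trans h₂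
  have b₁ := pow_le_pow_left₀ (norm_nonneg _) a₁ 2
  have b₂ := pow_le_pow_left₀ (norm_nonneg _) a₂ 2
  nlinarith

theorem torusDist_le_period {L : ℝ} (hL : 0 < L) (x y : Pt) : torusDist L x y ≤ L := by
  refine Real.sqrt_le_iff.2 ⟨hL.le, ?_⟩
  have a₁ := AddCircle.norm_le_half_period L (x := ((x.1 - y.1 : ℝ) : AddCircle L)) hL.ne'
  have a₂ := AddCircle.norm_le_half_period L (x := ((x.2 - y.2 : ℝ) : AddCircle L)) hL.ne'
  rw [abs_of_pos hL] at a₁ a₂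
  have b₁ := pow_le_pow_left₀ (norm_nonneg _) a₁ 2
  have b₂ := pow_le_pow_left₀ (norm_nonneg _) a₂ 2
  nlinarith

/-- Up to half a period wrapping around gives no shortcut. This supplies a point at a prescribed
distance from the target, the centre of a disc inside the annulus. -/
theorem torusDist_horizontal {L h : ℝ} (hL : 0 < L) (h0 : 0 ≤ h) (h1 : h ≤ L / 2) (t : Pt) :
    torusDist L (t.1 + h, t.2) t = h := by
  have : ‖((h : ℝ) : AddCircle L)‖ = h := by
    rw [(AddCircle.norm_coe_eq_abs_iff L hL.ne').2, abs_of_nonneg h0]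
    rwa [abs_of_nonneg h0, abs_of_pos hL]
  simp only [torusDist, add_sub_cancel_left, sub_self, this, AddCircle.coe_zero, norm_zero]
  rw [zero_pow two_ne_zero, add_zero, Real.sqrt_sq h0]

theorem coe_add_int_mul_period (L x : ℝ) (m : ℤ) :
    ((x + m * L : ℝ) : AddCircle L) = (x : AddCircle L) := by
  rw [AddCircle.coe_add, add_eq_left, AddCircle.coe_eq_zero_iff]
  exact ⟨m, by simp⟩

/-- Moving from `x` towards `t` by `h` reduces the distance to `t` by `h`. -/
theorem exists_torusDist_toward {L h : ℝ} {x t : Pt} (h0 : 0 ≤ h) (hd : 0 < torusDist L x t)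
    (h1 : h ≤ torusDist L x t) :
    ∃ z : Pt, torusDist L x z ≤ h ∧ torusDist L z t ≤ torusDist L x t - h := by
  set d := torusDist L x t with hdd
  set m₁ := round (L⁻¹ * (x.1 - t.1)) with hm₁
  set m₂ := round (L⁻¹ * (x.2 - t.2)) with hm₂
  set e₁ := x.1 - t.1 - m₁ * L with he₁
  set e₂ := x.2 - t.2 - m₂ * L with he₂
  have hdist : d = √(e₁ ^ 2 + e₂ ^ 2) := by
    rw [hdd, torusDist, AddCircle.norm_eq, AddCircle.norm_eq, sq_abs, sq_abs]
  have scale : ∀ s : ℝ, 0 ≤ s → √((s * e₁) ^ 2 + (s * e₂) ^ 2) = s * d := by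
    intro s hs
    rw [hdist, mul_pow, mul_pow, ← mul_add, Real.sqrt_mul (by positivity), Real.sqrt_sq hs]
  have hs0 : 0 ≤ h / d := by positivity
  have hs1 : h / d ≤ 1 := (div_le_one hd).2 h1
  have hhd : h / d * d = h := div_mul_cancel₀ _ hd.ne'
  have sq_norm : ∀ y : ℝ, ‖(y : AddCircle L)‖ ^ 2 ≤ y ^ 2 := fun y => by
    rw [← sq_abs y]; exact pow_le_pow_left₀ (norm_nonneg _) (norm_coe_le_abs L y) 2
  refine ⟨(x.1 - h / d * e₁, x.2 - h / d * e₂), ?_, ?_⟩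
  · calc _ ≤ √((h / d * e₁) ^ 2 + (h / d * e₂) ^ 2) := by
          refine Real.sqrt_le_sqrt (add_le_add ?_ ?_)
          · simpa using sq_norm (h / d * e₁)
          · simpa using sq_norm (h / d * e₂)
      _ = h := by rw [scale _ hs0, hhd]
  · calc _ ≤ √(((1 - h / d) * e₁) ^ 2 + ((1 - h / d) * e₂) ^ 2) := by
          refine Real.sqrt_le_sqrt (add_le_add ?_ ?_)
          · convert! sq_norm ((1 - h / d) * e₁) using 3
            rw [← coe_add_int_mul_period L _ (-m₁)]; congr 1; simp only [he₁]; push_cast; ring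
          · convert! sq_norm ((1 - h / d) * e₂) using 3
            rw [← coe_add_int_mul_period L _ (-m₂)]; congr 1; simp only [he₂]; push_cast; ring
      _ = d - h := by rw [scale _ (by linarith)]; linarith

/-- Every point of the plane has a representative in the fundamental square. -/
theorem exists_representative {L : ℝ} (hL : 0 < L) (z : Pt) :
    ∃ w : Pt, (0 ≤ w.1 ∧ w.1 < L) ∧ (0 ≤ w.2 ∧ w.2 < L) ∧
      ∀ y, torusDist L y w = torusDist L y z := by
  have key : ∀ a : ℝ, ∃ b : ℝ, (0 ≤ b ∧ b < L) ∧
      ∀ y : ℝ, ((y - b : ℝ) : AddCircle L) = ((y - a : ℝ) : AddCircle L) := by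
    intro a
    refine ⟨toIcoMod hL 0 a, by simpa using toIcoMod_mem_Ico hL 0 a, fun y => ?_⟩
    rw [← coe_add_int_mul_period L (y - a) (toIcoDiv hL 0 a)]
    congr 1
    rw [← self_sub_toIcoDiv_zsmul, zsmul_eq_mul]; ring
  obtain ⟨b₁, hb₁, h₁⟩ := key z.1
  obtain ⟨b₂, hb₂, h₂⟩ := key z.2
  exact ⟨(b₁, b₂), hb₁, hb₂, fun y => by simp only [torusDist, h₁, h₂]⟩

end Torus

/-! ### Partial averaging over independent coins (deferred decisions). -/

section Resample

variable {α : Type*} [DecidableEq α]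

/-- The expectation of `g` when the coins in `F` are tossed afresh, independently and with success
probabilities `p`, while the outcome `S` of the other coins is kept. -/
def resample (p : α → ℝ) (F : Finset α) (g : Finset α → ℝ) (S : Finset α) : ℝ :=
  ∑ T ∈ F.powerset, ((∏ e ∈ T, p e) * ∏ e ∈ F \ T, (1 - p e)) * g ((S \ F) ∪ T)

variable {p : α → ℝ} {F G : Finset α} {g h : Finset α → ℝ}

theorem resample_empty (p : α → ℝ) (g : Finset α → ℝ) (S : Finset α) :
    resample p ∅ g S = g S := by
  simp [resample]

/-- Conditioning on a single coin; the recursion behind the inductions on `F`. -/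
theorem resample_insert {e : α} (he : e ∉ F) (g : Finset α → ℝ) (S : Finset α) :
    resample p (insert e F) g S =
      p e * resample p F g (insert e S) + (1 - p e) * resample p F g (S.erase e) := by
  unfold resample
  rw [Finset.sum_powerset_insert he, add_comm, Finset.mul_sum, Finset.mul_sum]
  congr 1
  · refine Finset.sum_congr rfl fun T hT => ?_
    have hT' := Finset.mem_powerset.1 hT
    have heT : e ∉ T := fun h => he (hT' h)
    have h1 : insert e F \ insert e T = F \ T := by
      ext z; simp only [Finset.mem_sdiff, Finset.mem_insert]; grind
    have h2 : S \ insert e F ∪ insert e T = insert e S \ F ∪ T := by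
      ext z; simp only [Finset.mem_sdiff, Finset.mem_insert, Finset.mem_union]; grind
    rw [h1, h2, Finset.prod_insert heT]; ring
  · refine Finset.sum_congr rfl fun T hT => ?_
    have hT' := Finset.mem_powerset.1 hT
    have heT : e ∉ T := fun h => he (hT' h)
    have h1 : insert e F \ T = insert e (F \ T) := by
      ext z; simp only [Finset.mem_sdiff, Finset.mem_insert]; grind
    have h2 : S \ insert e F ∪ T = S.erase e \ F ∪ T := by
      ext z; simp only [Finset.mem_sdiff, Finset.mem_insert, Finset.mem_union, Finset.mem_erase]
      grind
    rw [h1, h2, Finset.prod_insert (by simp [he])]; ring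

/-- Fubini for disjoint groups of coins: the current holder's coins can be tossed before all later
ones. -/
theorem resample_union (hFG : Disjoint F G) (g : Finset α → ℝ) (S : Finset α) :
    resample p (F ∪ G) g S = resample p F (resample p G g) S := by
  induction F using Finset.induction_on generalizing S with
  | empty => simp [resample_empty]
  | insert e F he ih =>
    rw [Finset.disjoint_insert_left] at hFG
    rw [Finset.insert_union, resample_insert (by simp [he, hFG.1]), resample_insert he,
      ih hFG.2, ih hFG.2]

theorem resample_const (b : ℝ) (S : Finset α) : resample p F (fun _ => b) S = b := by
  induction F using Finset.induction_on generalizing S with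
  | empty => simp [resample_empty]
  | insert e F he ih => rw [resample_insert he, ih, ih]; ring

/-- The comparison is needed only at outcomes agreeing with `S` off `F`, so whatever the kept coins
determine, such as the next hop, may be used in it. -/
theorem resample_mono (hp0 : ∀ e, 0 ≤ p e) (hp1 : ∀ e, p e ≤ 1) {S : Finset α}
    (hgh : ∀ S', (∀ e ∉ F, e ∈ S' ↔ e ∈ S) → g S' ≤ h S') :
    resample p F g S ≤ resample p F h S := by
  refine Finset.sum_le_sum fun T hT => mul_le_mul_of_nonneg_left (hgh _ fun e he => ?_)
    (mul_nonneg (Finset.prod_nonneg fun e _ => hp0 e)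
      (Finset.prod_nonneg fun e _ => sub_nonneg.2 (hp1 e)))
  have : e ∉ T := fun h => he (Finset.mem_powerset.1 hT h)
  simp [he, this]

theorem resample_le_of_forall_le (hp0 : ∀ e, 0 ≤ p e) (hp1 : ∀ e, p e ≤ 1) {S : Finset α} {b : ℝ}
    (hg : ∀ S', (∀ e ∉ F, e ∈ S' ↔ e ∈ S) → g S' ≤ b) : resample p F g S ≤ b :=
  (resample_mono hp0 hp1 hg).trans_eq (resample_const b S)

theorem resample_le_of_subset (hp0 : ∀ e, 0 ≤ p e) (hp1 : ∀ e, p e ≤ 1) (hFG : F ⊆ G) {b : ℝ}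
    (hg : ∀ S, resample p F g S ≤ b) (S : Finset α) : resample p G g S ≤ b := by
  rw [← Finset.sdiff_union_of_subset hFG, resample_union Finset.sdiff_disjoint]
  exact resample_le_of_forall_le hp0 hp1 fun S' _ => hg S'

theorem resample_add_mul (b d : ℝ) (S : Finset α) :
    resample p F (fun S => b + d * g S) S = b + d * resample p F g S := by
  conv_rhs => rw [← resample_const (p := p) (F := F) b S]
  simp only [resample, Finset.mul_sum, ← Finset.sum_add_distrib]
  exact Finset.sum_congr rfl fun T _ => by ring

theorem resample_sum {ι : Type*} (I : Finset ι) (f : ι → Finset α → ℝ) (S : Finset α) :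
    resample p F (fun S => ∑ i ∈ I, f i S) S = ∑ i ∈ I, resample p F (f i) S := by
  simp only [resample, Finset.mul_sum]
  exact Finset.sum_comm

/-- The probability that all coins in `A` fail. -/
theorem resample_disjoint {A : Finset α} (hA : A ⊆ F) (S : Finset α) :
    resample p F (fun S => if Disjoint A S then 1 else 0) S = ∏ e ∈ A, (1 - p e) := by
  have key : ∀ S, resample p A (fun S => if Disjoint A S then (1 : ℝ) else 0) S =
      ∏ e ∈ A, (1 - p e) := by
    intro S
    rw [resample, Finset.sum_eq_single ∅]
    · simp [Finset.disjoint_sdiff]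
    · intro T hT hne
      rw [if_neg, mul_zero]
      intro hd
      obtain ⟨e, he⟩ := Finset.nonempty_iff_ne_empty.2 hne
      exact (Finset.disjoint_left.1 hd) (Finset.mem_powerset.1 hT he) (by simp [he])
    · simp
  rw [← Finset.sdiff_union_of_subset hA, resample_union Finset.sdiff_disjoint]
  simp only [funext key, resample_const]

end Resample

theorem prod_one_sub_le_exp_neg_sum {α : Type*} {p : α → ℝ} (hp1 : ∀ e, p e ≤ 1)
    (A : Finset α) :
    ∏ e ∈ A, (1 - p e) ≤ Real.exp (-∑ e ∈ A, p e) := by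
  rw [← Finset.sum_neg_distrib, Real.exp_sum]
  exact Finset.prod_le_prod (fun e _ => sub_nonneg.2 (hp1 e)) fun e _ => by
    linarith [Real.add_one_le_exp (-p e)]

noncomputable section

open scoped Classical

/-! ### Deterministic behaviour of the routing. -/

section Routing

variable {c : ℝ} {n : ℕ} {a : ℝ} {next : View → Pt} {V : Finset Pt} {S : Finset (Sym2 Pt)}
  {t : Pt}

/-- Every node that is not joined to `t` by a local edge has a local contact closer to `t`. -/
def HasCloserContacts (c : ℝ) (n : ℕ) (V : Finset Pt) (t : Pt) : Prop :=
  ∀ x ∈ V, localRadius c n ≤ torusDist √n x t →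
    ∃ y ∈ V, torusDist √n x y < localRadius c n ∧ torusDist √n y t < torusDist √n x t

/-- The message in state `p` reaches `t` in at most `k` hops. -/
def ReachesWithin (c : ℝ) (n : ℕ) (next : View → Pt) (V : Finset Pt) (S : Finset (Sym2 Pt))
    (t : Pt) (k : ℕ) (p : Pt × ℝ) : Prop :=
  ∃ j ≤ k, ((hop c n next V S t)^[j] p).1 = t

theorem reachesWithin_of_eq (k : ℕ) (r : ℝ) : ReachesWithin c n next V S t k (t, r) :=
  ⟨0, Nat.zero_le k, rfl⟩

theorem ReachesWithin.of_hop {k : ℕ} {p : Pt × ℝ}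
    (h : ReachesWithin c n next V S t k (hop c n next V S t p)) :
    ReachesWithin c n next V S t (k + 1) p := by
  obtain ⟨j, hj, h⟩ := h
  exact ⟨j + 1, by omega, by rwa [Function.iterate_succ_apply]⟩

theorem ReachesWithin.mono {k l : ℕ} {p : Pt × ℝ} (hkl : k ≤ l)
    (h : ReachesWithin c n next V S t k p) : ReachesWithin c n next V S t l p := by
  obtain ⟨j, hj, h⟩ := h
  exact ⟨j, hj.trans hkl, h⟩

/-- Decentralisation: the arbitrary choices see only the holder's own shortcuts, so coins not
incident to it cannot influence the hop. -/
theorem hop_congr {S S' : Finset (Sym2 Pt)} {x : Pt} (h : ∀ y, s(x, y) ∈ S ↔ s(x, y) ∈ S')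
    (r : ℝ) : hop c n next V S t (x, r) = hop c n next V S' t (x, r) := by
  have : shortcutContacts V S x = shortcutContacts V S' x := by
    unfold shortcutContacts
    exact Finset.filter_congr fun y _ => h y
  simp only [hop, this]

/-- One hop delivers the message, or uses a shortcut into the annulus, or, if there is none, a local
edge that leads closer to the target. -/
theorem hop_cases (hnext : IsApproxGreedy n next) (hV : HasCloserContacts c n V t) {x : Pt}
    (hx : x ∈ V) (ht : t ∈ V) (hxt : x ≠ t) (r : ℝ) :
    (hop c n next V S t (x, r)).1 = t ∨ localRadius c n ≤ torusDist √n x t ∧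
    ((∃ y ∈ V, torusDist √n y t ≤ r / 2 ∧ r / 4 < torusDist √n y t ∧
      hop c n next V S t (x, r) = (y, r / 2)) ∨
    ((∀ y ∈ V, s(x, y) ∈ S → torusDist √n y t ≤ r / 2 → torusDist √n y t ≤ r / 4) ∧
      ∃ y ∈ V, torusDist √n x y < localRadius c n ∧ torusDist √n y t < torusDist √n x t ∧
        hop c n next V S t (x, r) = (y, if torusDist √n y t ≤ r / 2 then r / 2 else r))) := by
  have hg := hnext ⟨x, t, r, localContacts c n V x, shortcutContacts V S x⟩
  have hhop : hop c n next V S t (x, r) =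
      (next ⟨x, t, r, localContacts c n V x, shortcutContacts V S x⟩,
        if torusDist √n (next ⟨x, t, r, localContacts c n V x, shortcutContacts V S x⟩) t ≤ r / 2
        then r / 2 else r) := rfl
  generalize next ⟨x, t, r, localContacts c n V x, shortcutContacts V S x⟩ = z at hg hhop
  by_cases h1 : t ∈ localContacts c n V x ∪ shortcutContacts V S x
  · left
    rw [if_pos h1] at hg
    rw [hhop, hg]
  have hR : localRadius c n ≤ torusDist √n x t := by
    by_contra! hlt
    refine h1 (Finset.mem_union_left _ ?_)
    simp only [localContacts, Finset.mem_filter]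
    exact ⟨ht, hxt.symm, hlt⟩
  refine Or.inr ⟨hR, ?_⟩
  rw [if_neg h1] at hg
  split_ifs at hg with h2 h3
  · left
    simp only [View.annulusShortcuts, shortcutContacts, Finset.mem_filter, not_le] at hg
    refine ⟨z, hg.1.1, hg.2.1, hg.2.2, ?_⟩
    rw [hhop, if_pos hg.2.1]
  · right
    simp only [View.closerLocals, localContacts, Finset.mem_filter] at hg
    refine ⟨fun y hy hs hd => ?_, z, hg.1.1, hg.1.2.2, hg.2, hhop⟩
    by_contra hlt
    refine h2 ⟨y, ?_⟩
    simp only [View.annulusShortcuts, shortcutContacts, Finset.mem_filter]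
    exact ⟨⟨hy, hs⟩, hd, hlt⟩
  · exfalso
    obtain ⟨y, hy, hxy, hyt⟩ := hV x hx hR
    refine h3 ⟨y, ?_⟩
    simp only [View.closerLocals, localContacts, Finset.mem_filter]
    refine ⟨⟨hy, ?_, hxy⟩, hyt⟩
    rintro rfl
    exact lt_irrefl _ hyt

/-- The nodes closer to `t` than `x`. -/
def closerNodes (n : ℕ) (V : Finset Pt) (t x : Pt) : Finset Pt :=
  V.filter fun y => torusDist √n y t < torusDist √n x t

theorem card_closerNodes_le {ρ : ℝ} {N : ℕ}
    (hN : (V.filter fun y => torusDist √n y t ≤ ρ).card ≤ N) {x : Pt}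
    (hx : torusDist √n x t ≤ ρ) : (closerNodes n V t x).card ≤ N :=
  (Finset.card_le_card (Finset.monotone_filter_right V fun _ _ hy => (hy.trans_le hx).le)).trans hN

theorem card_closerNodes_lt {x y : Pt} (hy : y ∈ V)
    (hxy : torusDist √n y t < torusDist √n x t) :
    (closerNodes n V t y).card < (closerNodes n V t x).card := by
  refine Finset.card_lt_card ⟨Finset.monotone_filter_right V fun _ _ hz => hz.trans hxy, ?_⟩
  intro h
  have := h (Finset.mem_filter.2 ⟨hy, hxy⟩)
  exact lt_irrefl _ (Finset.mem_filter.1 this).2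

/-- Near the target the message is delivered, whatever the shortcuts are. -/
theorem reachesWithin_near (hnext : IsApproxGreedy n next) (hV : HasCloserContacts c n V t)
    (ht : t ∈ V) (hR : 0 < localRadius c n) {ρ : ℝ} {N : ℕ}
    (hN : (V.filter fun y => torusDist √n y t ≤ ρ).card ≤ N) (k : ℕ) :
    -- `j` bounds the halvings still possible. Between halvings the set of closer nodes shrinks at
    -- every hop, so each halving costs at most `N + 1` hops.
    ∀ (j : ℕ) (x : Pt) (r : ℝ), x ∈ V → torusDist √n x t ≤ r → r ≤ ρ →
      r ≤ 2 ^ j * (localRadius c n / 2) → j * (N + 1) + (closerNodes n V t x).card + 1 ≤ k →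
      ReachesWithin c n next V S t k (x, r) := by
  induction k with
  | zero => intro j x r _ _ _ _ h; omega
  | succ k ih =>
    intro j x r hx hxr hrρ hrj hk
    by_cases hxt : x = t
    · subst hxt; exact reachesWithin_of_eq _ _
    have hr0 : 0 ≤ r := (torusDist_nonneg _ _ _).trans hxr
    rcases hop_cases (S := S) hnext hV hx ht hxt r with h | ⟨hxR, h⟩
    · exact ReachesWithin.mono (by omega) (ReachesWithin.of_hop (k := 0) ⟨0, le_rfl, h⟩)
    have halve : ∀ y ∈ V, torusDist √n y t ≤ r / 2 →
        ReachesWithin c n next V S t k (y, r / 2) := by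
      intro y hy hyr
      -- For `j = 0` the radius is at most R/2, so `t` would already be a local contact of `x`.
      obtain _ | j := j
      · simp only [pow_zero, one_mul] at hrj
        linarith
      refine ih j y (r / 2) hy hyr (by linarith) (by rw [pow_succ] at hrj; linarith) ?_
      have := card_closerNodes_le (V := V) (n := n) hN (x := y) (t := t) (by linarith)
      have e : (j + 1) * (N + 1) = j * (N + 1) + N + 1 := by ring
      omega
    refine ReachesWithin.of_hop ?_
    rcases h with ⟨y, hy, hyr, -, h⟩ | ⟨-, y, hy, -, hyx, h⟩
    · rw [h]; exact halve y hy hyr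
    · rw [h]
      split_ifs with hyr
      · exact halve y hy hyr
      · refine ih j y r hy (hyx.le.trans hxr) hrρ hrj ?_
        have := card_closerNodes_lt (n := n) (t := t) hy hyx
        omega

end Routing

/-! ### Probability of late delivery for a fixed node set. -/

section Delivery

variable {c : ℝ} {n : ℕ} {a : ℝ} {next : View → Pt} {V : Finset Pt} {S : Finset (Sym2 Pt)}
  {t : Pt}

theorem mk_mem_nodePairs {V : Finset Pt} {x y : Pt} :
    s(x, y) ∈ nodePairs V ↔ (x ∈ V ∧ y ∈ V) ∧ x ≠ y := by
  simp [nodePairs]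

theorem nodePairs_mono {U V : Finset Pt} (h : U ⊆ V) : nodePairs U ⊆ nodePairs V := by
  intro e
  induction e with | _ x y
  simp only [mk_mem_nodePairs]
  exact fun ⟨⟨hx, hy⟩, hxy⟩ => ⟨⟨h hx, h hy⟩, hxy⟩

theorem nodePairs_insert {U : Finset Pt} {x : Pt} (hx : x ∉ U) :
    nodePairs (insert x U) = U.image (fun y => s(x, y)) ∪ nodePairs U := by
  ext e
  induction e with | _ y z
  simp only [mk_mem_nodePairs, Finset.mem_union, Finset.mem_image, Finset.mem_insert,
    Sym2.eq_iff]
  grind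

theorem disjoint_star_nodePairs {U : Finset Pt} {x : Pt} (hx : x ∉ U) :
    Disjoint (U.image (fun y => s(x, y))) (nodePairs U) := by
  rw [Finset.disjoint_left]
  intro e he
  obtain ⟨y, -, rfl⟩ := Finset.mem_image.1 he
  simp [mk_mem_nodePairs, hx]

theorem pairProb_mk (c : ℝ) (n : ℕ) (a : ℝ) (x y : Pt) :
    pairProb c n a s(x, y) = shortcutProb c n a x y := rfl

theorem pairProb_nonneg (ha : 0 ≤ a) (e : Sym2 Pt) : 0 ≤ pairProb c n a e := by
  induction e with | _ x y
  rw [pairProb_mk, shortcutProb]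
  split_ifs
  · exact le_min (by positivity) zero_le_one
  · exact le_rfl

theorem pairProb_le_one (e : Sym2 Pt) : pairProb c n a e ≤ 1 := by
  induction e with | _ x y
  rw [pairProb_mk, shortcutProb]
  split_ifs
  · exact min_le_right _ _
  · exact zero_le_one

/-- The expected number of shortcuts from a node at distance about `r` from `t` into the annulus
is at least `q`. -/
def HasAnnulusShortcuts (c : ℝ) (n : ℕ) (a : ℝ) (V : Finset Pt) (t : Pt) (q : ℝ) : Prop :=
  ∀ x ∈ V, ∀ r, 8 * localRadius c n < r → r ≤ √n → r / 2 < torusDist √n x t →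
    torusDist √n x t ≤ r →
    q ≤ ∑ y ∈ V.filter fun y => r / 4 < torusDist √n y t ∧ torusDist √n y t ≤ r / 2,
      shortcutProb c n a x y

/-- Probability that the message is late, when all pairs of nodes that are not farther from the
target than the current holder are resampled. -/
theorem resample_late_le (hnext : IsApproxGreedy n next) (hV : HasCloserContacts c n V t)
    (ht : t ∈ V) (hR : 1 ≤ localRadius c n) {N : ℕ}
    (hN : (V.filter fun y => torusDist √n y t ≤ 8 * localRadius c n).card ≤ N)
    (ha : 0 ≤ a) {q : ℝ} (hq : HasAnnulusShortcuts c n a V t q) (k : ℕ) :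
    ∀ (x : Pt) (r : ℝ), x ∈ V → r ≤ √n → torusDist √n x t ≤ r →
      (8 * localRadius c n < r → r / 2 < torusDist √n x t) → ∀ S,
      resample (pairProb c n a) (nodePairs (insert x (closerNodes n V t x)))
        (fun S => if ReachesWithin c n next V S t (k + (5 * N + 5)) (x, r) then 0 else 1) S ≤
      r * ((1 + Real.exp (-q)) / 2) ^ k := by
  have hp0 : ∀ e, 0 ≤ pairProb c n a e := fun e => pairProb_nonneg ha e
  have hp1 : ∀ e, pairProb c n a e ≤ 1 := fun e => pairProb_le_one e
  have hρ : 0 ≤ (1 + Real.exp (-q)) / 2 := by positivity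
  induction k with
  | zero =>
    intro x r hx hrL hxr hr S
    have hr0 : 0 ≤ r := (torusDist_nonneg _ _ _).trans hxr
    refine resample_le_of_forall_le hp0 hp1 fun S' _ => ?_
    split_ifs with h
    · positivity
    -- Since 8R = 2⁴ · R/2, the near zone needs at most 4(N + 1) + N + 1 = 5N + 5 hops. A late
    -- message therefore has r > 8R ≥ 1, and `r` dominates the indicator.
    · have : 8 * localRadius c n < r := by
        by_contra! hle
        refine h (reachesWithin_near hnext hV ht (by linarith) hN _ 4 x r hx hxr hle
          (by norm_num; linarith) ?_)
        have := card_closerNodes_le (n := n) hN (hxr.trans hle)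
        omega
      rw [pow_zero]; linarith
  | succ k ih =>
    intro x r hx hrL hxr hr S
    have hr0 : 0 ≤ r := (torusDist_nonneg _ _ _).trans hxr
    by_cases hle : r ≤ 8 * localRadius c n
    · refine resample_le_of_forall_le hp0 hp1 fun S' _ => ?_
      rw [if_pos]
      · positivity
      · refine reachesWithin_near hnext hV ht (by linarith) hN _ 4 x r hx hxr hle
          (by norm_num; linarith) ?_
        have := card_closerNodes_le (n := n) hN (hxr.trans hle)
        omega
    rw [not_le] at hle
    have hxr' := hr hle
    have hxt : x ≠ t := by
      rintro rfl
      have : torusDist √n x x = 0 := by simp [torusDist]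
      linarith
    set W := closerNodes n V t x with hW
    have hxW : x ∉ W := by simp [hW, closerNodes]
    set A : Finset Pt := V.filter fun y => r / 4 < torusDist √n y t ∧ torusDist √n y t ≤ r / 2
      with hA
    have hAW : A ⊆ W := by
      intro y hy
      simp only [hA, hW, closerNodes, Finset.mem_filter] at hy ⊢
      exact ⟨hy.1, by linarith⟩
    -- Bound with the coins of `x` fixed: r/2 times the power if some annulus coin succeeds, r times
    -- the power if all fail.
    have key : ∀ S, resample (pairProb c n a) (nodePairs W)
        (fun S => if ReachesWithin c n next V S t (k + 1 + (5 * N + 5)) (x, r) then 0 else 1) S ≤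
        r * ((1 + Real.exp (-q)) / 2) ^ k / 2 + r * ((1 + Real.exp (-q)) / 2) ^ k / 2 *
          (if Disjoint (A.image fun y => s(x, y)) S then 1 else 0) := by
      intro S
      -- No pair inside `W` contains `x`, so resampling these pairs leaves the present hop
      -- unchanged.
      have hS : ∀ S', (∀ e ∉ nodePairs W, e ∈ S' ↔ e ∈ S) →
          hop c n next V S' t (x, r) = hop c n next V S t (x, r) := fun S' hS' =>
        hop_congr (fun y => hS' _ (by simp [mk_mem_nodePairs, hxW])) r
      have step : ∀ y ∈ V, torusDist √n y t < torusDist √n x t → ∀ r' ≤ r, torusDist √n y t ≤ r' →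
          (8 * localRadius c n < r' → r' / 2 < torusDist √n y t) →
          hop c n next V S t (x, r) = (y, r') →
          resample (pairProb c n a) (nodePairs W) (fun S =>
            if ReachesWithin c n next V S t (k + 1 + (5 * N + 5)) (x, r) then 0 else 1) S ≤
          r' * ((1 + Real.exp (-q)) / 2) ^ k := by
        intro y hy hyx r' hrr hyr hr' hh
        refine le_trans (resample_mono hp0 hp1 (h := fun S =>
          if ReachesWithin c n next V S t (k + (5 * N + 5)) (y, r') then 0 else 1) ?_) ?_
        · intro S' hS'
          by_cases h : ReachesWithin c n next V S' t (k + (5 * N + 5)) (y, r')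
          · rw [if_pos h, if_pos]
            rw [← hh, ← hS S' hS'] at h
            exact h.of_hop.mono (by omega)
          · rw [if_neg h]
            split_ifs <;> norm_num
        -- The new holder and all nodes closer than it lie in `W`, so the coins required by the
        -- induction hypothesis are among those still being averaged.
        · refine resample_le_of_subset hp0 hp1 (nodePairs_mono ?_)
            (ih y r' hy (hrr.trans hrL) hyr hr') S
          intro z hz
          rcases Finset.mem_insert.1 hz with rfl | hz
          · exact Finset.mem_filter.2 ⟨hy, hyx⟩
          · have := Finset.mem_filter.1 hz
            exact Finset.mem_filter.2 ⟨this.1, this.2.trans hyx⟩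
      have hB : 0 ≤ r * ((1 + Real.exp (-q)) / 2) ^ k := by positivity
      rcases hop_cases (S := S) hnext hV hx ht hxt r with h | ⟨hxR, h⟩
      · refine (resample_le_of_forall_le hp0 hp1 (b := 0) fun S' hS' => ?_).trans
          (by split_ifs <;> linarith)
        rw [if_pos]
        exact ReachesWithin.mono (by omega)
          (ReachesWithin.of_hop (k := 0) ⟨0, le_rfl, by rw [hS S' hS']; exact h⟩)
      · rcases h with ⟨y, hy, hyr, hyr', h⟩ | ⟨hno, y, hy, hxy, hyx, h⟩
        · refine (step y hy (by linarith) (r / 2) (by linarith) hyr (fun _ => by linarith) h).trans ?_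
          split_ifs <;> linarith
        · have hd : Disjoint (A.image fun y => s(x, y)) S := by
            rw [Finset.disjoint_left]
            intro e he heS
            obtain ⟨z, hz, rfl⟩ := Finset.mem_image.1 he
            have hz' := (Finset.mem_filter.1 hz)
            have := hno z hz'.1 heS hz'.2.2
            linarith [hz'.2.1]
          rw [if_pos hd]
          -- A local hop is shorter than R < r/8. If it triggers a halving, the new distance still
          -- exceeds r/2 - r/8 > r/4, so the lower bound on the distance persists.
          have htri := torusDist_triangle √n x y t
          have hle' : (if torusDist √n y t ≤ r / 2 then r / 2 else r) ≤ r := by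
            split_ifs <;> linarith
          refine (step y hy hyx _ hle' ?_ (fun _ => ?_) h).trans ?_
          · split_ifs <;> linarith
          · split_ifs <;> linarith
          · have := mul_le_mul_of_nonneg_right hle' (pow_nonneg hρ k)
            linarith
    -- The star of `x` is averaged outside the pairs within `W`. All annulus coins fail with
    -- probability at most e^(-q), producing the factor (1 + e^(-q))/2.
    rw [nodePairs_insert hxW, resample_union (disjoint_star_nodePairs hxW)]
    refine (resample_mono hp0 hp1 fun S' _ => key S').trans ?_
    rw [resample_add_mul, resample_disjoint (Finset.image_subset_image hAW)]
    have hprod := prod_one_sub_le_exp_neg_sum hp1 (A.image fun y => s(x, y))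
    have hsum : q ≤ ∑ e ∈ A.image fun y => s(x, y), pairProb c n a e := by
      rw [Finset.sum_image fun y _ z _ h => Sym2.congr_right.1 h]
      exact hq x hx r hle hrL hxr' hxr
    have hexp := hprod.trans (Real.exp_le_exp.2 (neg_le_neg hsum))
    have hB : 0 ≤ r * ((1 + Real.exp (-q)) / 2) ^ k / 2 := by positivity
    have := mul_le_mul_of_nonneg_left hexp hB
    calc _ ≤ _ := add_le_add_right this _
      _ = _ := by rw [pow_succ]; ring

theorem sum_shortcutWeight_eq_resample (V : Finset Pt) (E : Finset (Sym2 Pt) → Prop) :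
    ∑ S ∈ (nodePairs V).powerset.filter E, shortcutWeight c n a V S =
      resample (pairProb c n a) (nodePairs V) (fun S => if E S then 1 else 0) ∅ := by
  rw [resample, Finset.sum_filter]
  refine Finset.sum_congr rfl fun S _ => ?_
  simp only [Finset.empty_sdiff, Finset.empty_union, shortcutWeight]
  split_ifs <;> simp

theorem sum_shortcutWeight_le_one (ha : 0 ≤ a) (V : Finset Pt) (E : Finset (Sym2 Pt) → Prop) :
    ∑ S ∈ (nodePairs V).powerset.filter E, shortcutWeight c n a V S ≤ 1 := by
  rw [sum_shortcutWeight_eq_resample]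
  refine resample_le_of_forall_le (pairProb_nonneg ha) pairProb_le_one fun S _ => ?_
  split_ifs <;> norm_num

/-- Given a node set that satisfies the three density conditions, the message is in time for all
pairs of nodes with large probability. -/
theorem le_sum_shortcutWeight_delivered (hn : 0 < n) (hnext : IsApproxGreedy n next)
    (hR : 1 ≤ localRadius c n) (ha : 0 ≤ a) {N : ℕ} {q K : ℝ}
    (hV : ∀ t ∈ V, HasCloserContacts c n V t)
    (hN : ∀ t ∈ V, (V.filter fun y => torusDist √n y t ≤ 8 * localRadius c n).card ≤ N)
    (hq : ∀ t ∈ V, HasAnnulusShortcuts c n a V t q) {k : ℕ} (hK : (k + (5 * N + 5) : ℕ) ≤ K)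
    {E : Finset (Sym2 Pt) → Prop}
    (hE : ∀ S, (∀ s ∈ V, ∀ t ∈ V, DeliveredWithin c n next V S s t K) → E S) :
    1 - V.card ^ 2 * (√n * ((1 + Real.exp (-q)) / 2) ^ k) ≤
      ∑ S ∈ (nodePairs V).powerset.filter E, shortcutWeight c n a V S := by
  have hp0 : ∀ e, 0 ≤ pairProb c n a e := fun e => pairProb_nonneg ha e
  have hp1 : ∀ e, pairProb c n a e ≤ 1 := fun e => pairProb_le_one e
  have hL : 0 < √(n : ℝ) := Real.sqrt_pos.2 (by exact_mod_cast hn)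
  rw [sum_shortcutWeight_eq_resample]
  set late : Pt × Pt → Finset (Sym2 Pt) → ℝ := fun st S =>
    if ReachesWithin c n next V S st.2 (k + (5 * N + 5)) (st.1, torusDist √n st.1 st.2)
      then 0 else 1 with hlate
  have hlate0 : ∀ st S, 0 ≤ late st S := by
    intro st S; simp only [hlate]; split_ifs <;> norm_num
  -- Union bound in pointwise form: if `E` fails, at least one pair is late.
  have h1 : resample (pairProb c n a) (nodePairs V)
      (fun S => 1 + (-1) * ∑ st ∈ V ×ˢ V, late st S) ∅ ≤
      resample (pairProb c n a) (nodePairs V) (fun S => if E S then 1 else 0) ∅ := by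
    refine resample_mono hp0 hp1 fun S _ => ?_
    split_ifs with h
    · linarith [Finset.sum_nonneg fun st (_ : st ∈ V ×ˢ V) => hlate0 st S]
    · have h : ¬ ∀ s ∈ V, ∀ t ∈ V, DeliveredWithin c n next V S s t K := fun hh => h (hE S hh)
      push Not at h
      obtain ⟨s, hs, t, ht, h⟩ := h
      have h2 : late (s, t) S = 1 := by
        simp only [hlate]
        rw [if_neg]
        rintro ⟨j, hj, hh⟩
        exact h ⟨j, le_trans (by exact_mod_cast hj) hK, hh⟩
      have := Finset.single_le_sum (f := fun st => late st S) (fun st _ => hlate0 st S)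
        (Finset.mk_mem_product hs ht)
      simp only [h2] at this
      linarith
  rw [resample_add_mul, resample_sum] at h1
  have h2 : ∑ st ∈ V ×ˢ V, resample (pairProb c n a) (nodePairs V) (late st) ∅ ≤
      ∑ st ∈ V ×ˢ V, √n * ((1 + Real.exp (-q)) / 2) ^ k := by
    refine Finset.sum_le_sum fun st hst => ?_
    obtain ⟨hs, ht⟩ := Finset.mem_product.1 hst
    -- At distance 0 the strict inequality r/2 < d fails. This covers s = t and distinct points
    -- identified on the torus.
    by_cases hpos : torusDist √n st.1 st.2 = 0
    · refine (resample_le_of_forall_le hp0 hp1 (b := 0) fun S' _ => ?_).trans (by positivity)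
      simp only [hlate]
      rw [if_pos]
      refine reachesWithin_near hnext (hV _ ht) ht (by linarith) (hN _ ht) _ 4 _ _ hs le_rfl
        (by rw [hpos]; linarith) (by rw [hpos]; linarith) ?_
      have := card_closerNodes_le (n := n) (hN _ ht) (x := st.1) (by rw [hpos]; linarith)
      omega
    have hpos' := lt_of_le_of_ne (torusDist_nonneg √n st.1 st.2) (Ne.symm hpos)
    refine (resample_le_of_subset hp0 hp1 (nodePairs_mono ?_) (resample_late_le hnext (hV _ ht) ht
      hR (hN _ ht) ha (hq _ ht) k _ _ hs (torusDist_le_period hL _ _) le_rfl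
      fun _ => by linarith) ∅).trans ?_
    · exact Finset.insert_subset hs (Finset.filter_subset _ _)
    · have := torusDist_le_period hL st.1 st.2
      gcongr
  rw [Finset.sum_const, Finset.card_product, nsmul_eq_mul, Nat.cast_mul, ← sq] at h2
  linarith

end Delivery

/-! ### Laplace transform, mean and tail bounds of the Poisson process. -/

section Nodes

theorem lintegral_poissonMeasure (r : ℝ≥0) (f : ℕ → ℝ≥0∞) :
    ∫⁻ N, f N ∂(poissonMeasure r) =
      ∑' N : ℕ, ENNReal.ofReal (Real.exp (-r) * r ^ N / (N.factorial : ℝ)) * f N := by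
  rw [poissonMeasure, lintegral_sum_measure]
  simp [lintegral_smul_measure]

theorem lintegral_pow_poissonMeasure (r : ℝ≥0) {s : ℝ} (hs : 0 ≤ s) :
    ∫⁻ N, ENNReal.ofReal s ^ N ∂(poissonMeasure r) = ENNReal.ofReal (Real.exp (r * (s - 1))) := by
  have h : HasSum (fun N : ℕ => Real.exp (-r) * r ^ N / (N.factorial : ℝ) * s ^ N)
      (Real.exp (r * (s - 1))) := by
    convert! (NormedSpace.expSeries_div_hasSum_exp (r * s : ℝ)).mul_left (Real.exp (-r)) using 1
    · ext N; rw [mul_pow]; ring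
    · rw [← Real.exp_eq_exp_ℝ, ← Real.exp_add]; congr 1; ring
  rw [lintegral_poissonMeasure, ← h.tsum_eq,
    ENNReal.ofReal_tsum_of_nonneg (fun N => by positivity) h.summable]
  refine tsum_congr fun N => ?_
  rw [ENNReal.ofReal_mul (by positivity), ENNReal.ofReal_pow hs]

theorem lintegral_id_poissonMeasure (r : ℝ≥0) :
    ∫⁻ N, (N : ℝ≥0∞) ∂(poissonMeasure r) = r := by
  have h : HasSum (fun N : ℕ => Real.exp (-r) * r ^ N / (N.factorial : ℝ) * N) r := by
    rw [← hasSum_nat_add_iff' 1]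
    convert! (hasSum_one_poissonMeasure r).mul_left (r : ℝ) using 1
    · ext N
      rw [Nat.factorial_succ]
      push_cast
      field_simp
      ring
    · simp
  have h' : (r : ℝ≥0∞) =
      ENNReal.ofReal (∑' N : ℕ, Real.exp (-r) * r ^ N / (N.factorial : ℝ) * N) := by
    rw [h.tsum_eq, ENNReal.ofReal_coe_nnreal]
  rw [lintegral_poissonMeasure, h', ENNReal.ofReal_tsum_of_nonneg (fun N => by positivity) h.summable]
  refine tsum_congr fun N => ?_
  rw [ENNReal.ofReal_mul (by positivity), ENNReal.ofReal_natCast]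

instance isProbabilityMeasure_nodeLaw (n : ℕ) : IsProbabilityMeasure (nodeLaw n) := by
  unfold nodeLaw; infer_instance

theorem lintegral_nodeLaw (n : ℕ) {f : NodeSpace → ℝ≥0∞} (hf : Measurable f) :
    ∫⁻ ω, f ω ∂(nodeLaw n) = ∫⁻ N, ∫⁻ u, f (N, u)
      ∂(Measure.infinitePi fun _ : ℕ => (volume : Measure (unitInterval × unitInterval)))
      ∂(poissonMeasure (n : ℝ≥0)) := by
  rw [nodeLaw, lintegral_prod _ hf.aemeasurable]

/-- Given the number N of points, independence gives s^N; averaging over N is the Poisson generating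
function. -/
theorem lintegral_nodeLaw_prod (n : ℕ) {g : unitInterval × unitInterval → ℝ≥0∞}
    (hg : Measurable g) {s : ℝ} (hs : 0 ≤ s) (hgs : ∫⁻ u, g u = ENNReal.ofReal s) :
    ∫⁻ ω, ∏ i ∈ Finset.range ω.1, g (ω.2 i) ∂(nodeLaw n) =
      ENNReal.ofReal (Real.exp (n * (s - 1))) := by
  rw [lintegral_nodeLaw n (measurable_from_prod_countable_right fun N => by
    dsimp only; exact Finset.measurable_fun_prod _ fun i _ => by fun_prop)]
  rw [← NNReal.coe_natCast, ← lintegral_pow_poissonMeasure _ hs]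
  refine lintegral_congr fun N => ?_
  dsimp only
  have hind : iIndepFun (fun i (u : ℕ → unitInterval × unitInterval) => g (u i))
      (Measure.infinitePi fun _ : ℕ => volume) := iIndepFun_infinitePi (X := fun _ => g) fun _ => hg
  rw [lintegral_prod_eq_prod_lintegral_of_indepFun (Finset.range N) _ hind
    fun i => by fun_prop]
  rw [Finset.prod_congr rfl (g := fun _ => ENNReal.ofReal s), Finset.prod_const, Finset.card_range]
  intro i _
  rw [← hgs]
  exact (measurePreserving_eval_infinitePi
    (fun _ : ℕ => (volume : Measure (unitInterval × unitInterval))) i).lintegral_comp hg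

/-- Campbell's formula, needed to evaluate the normalisation of the shortcut probabilities. -/
theorem lintegral_nodeLaw_sum (n : ℕ) {g : unitInterval × unitInterval → ℝ≥0∞}
    (hg : Measurable g) :
    ∫⁻ ω, ∑ i ∈ Finset.range ω.1, g (ω.2 i) ∂(nodeLaw n) = n * ∫⁻ u, g u := by
  rw [lintegral_nodeLaw n (measurable_from_prod_countable_right fun N => by
    dsimp only; exact Finset.measurable_fun_sum _ fun i _ => by fun_prop)]
  have h : ∀ N : ℕ, ∫⁻ u, ∑ i ∈ Finset.range N, g (u i)
      ∂(Measure.infinitePi fun _ : ℕ => (volume : Measure (unitInterval × unitInterval))) =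
      N * ∫⁻ u, g u := by
    intro N
    rw [lintegral_finsetSum _ fun i _ => by fun_prop,
      Finset.sum_congr rfl (g := fun _ => ∫⁻ u, g u), Finset.sum_const, Finset.card_range,
      nsmul_eq_mul]
    intro i _
    exact (measurePreserving_eval_infinitePi
      (fun _ : ℕ => (volume : Measure (unitInterval × unitInterval))) i).lintegral_comp hg
  simp only [h]
  rw [lintegral_mul_const _ (by fun_prop), lintegral_id_poissonMeasure]
  simp

/-- The number of indices whose location lies in `B`. -/
def indexCount (B : Set (unitInterval × unitInterval)) (ω : NodeSpace) : ℕ :=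
  ((Finset.range ω.1).filter fun i => ω.2 i ∈ B).card

theorem lintegral_exp_indexCount (n : ℕ) {B : Set (unitInterval × unitInterval)}
    (hB : MeasurableSet B) (σ : ℝ) :
    ∫⁻ ω, ENNReal.ofReal (Real.exp (σ * indexCount B ω)) ∂(nodeLaw n) =
      ENNReal.ofReal (Real.exp (n * (volume.real B * (Real.exp σ - 1)))) := by
  have hB1 : volume.real B ≤ 1 := measureReal_le_one
  have hB0 : 0 ≤ volume.real B := measureReal_nonneg
  have h := lintegral_nodeLaw_prod n
    (g := fun u => ENNReal.ofReal (if u ∈ B then Real.exp σ else 1))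
    (s := 1 + volume.real B * (Real.exp σ - 1))
    (ENNReal.measurable_ofReal.comp (Measurable.ite hB measurable_const measurable_const))
    (by nlinarith [Real.exp_pos σ]) ?_
  · rw [add_sub_cancel_left] at h
    rw [← h]
    refine lintegral_congr fun ω => ?_
    rw [← ENNReal.ofReal_prod_of_nonneg fun i _ => by split_ifs <;> positivity]
    congr 1
    rw [Finset.prod_ite, Finset.prod_const, Finset.prod_const_one, mul_one, ← Real.exp_nat_mul,
      mul_comm, indexCount]
  · have : (fun u => ENNReal.ofReal (if u ∈ B then Real.exp σ else 1)) =
        fun u => B.indicator (fun _ => ENNReal.ofReal (Real.exp σ)) u +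
          Bᶜ.indicator (fun _ => 1) u := by
      ext u
      by_cases hu : u ∈ B <;> simp [hu]
    rw [this, lintegral_add_left (measurable_const.indicator hB), lintegral_indicator_const hB,
      lintegral_indicator_const hB.compl, one_mul, ← ofReal_measureReal, ← ofReal_measureReal,
      measureReal_compl hB, probReal_univ, ← ENNReal.ofReal_mul (by positivity),
      ← ENNReal.ofReal_add (by positivity) (by linarith)]
    congr 1; ring

theorem measurable_indexCount {B : Set (unitInterval × unitInterval)} (hB : MeasurableSet B) :
    Measurable (indexCount B) := by
  refine measurable_from_prod_countable_right fun N => ?_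
  have : (fun u : ℕ → unitInterval × unitInterval => indexCount B (N, u)) =
      fun u => ∑ i ∈ Finset.range N, if u i ∈ B then 1 else 0 := by
    ext u; rw [indexCount, Finset.card_filter]
  rw [this]
  refine Finset.measurable_sum _ fun i _ => ?_
  exact Measurable.ite (measurable_pi_apply i hB) measurable_const measurable_const

/-- Chernoff bound. -/
theorem nodeLaw_exp_indexCount_ge (n : ℕ) {B : Set (unitInterval × unitInterval)}
    (hB : MeasurableSet B) (σ b : ℝ) :
    nodeLaw n {ω | b ≤ σ * indexCount B ω} ≤
      ENNReal.ofReal (Real.exp (n * (volume.real B * (Real.exp σ - 1)) - b)) := by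
  have hm : Measurable fun ω => ENNReal.ofReal (Real.exp (σ * indexCount B ω)) := by
    have := measurable_indexCount hB
    fun_prop
  have h := mul_meas_ge_le_lintegral hm (μ := nodeLaw n) (ENNReal.ofReal (Real.exp b))
  rw [lintegral_exp_indexCount n hB] at h
  have hset : {ω | b ≤ σ * indexCount B ω} =
      {ω | ENNReal.ofReal (Real.exp b) ≤ ENNReal.ofReal (Real.exp (σ * indexCount B ω))} := by
    ext ω
    simp only [Set.mem_ofPred_eq]
    rw [ENNReal.ofReal_le_ofReal_iff (by positivity), Real.exp_le_exp]
  rw [hset, Real.exp_sub, ENNReal.ofReal_div_of_pos (Real.exp_pos _),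
    ENNReal.le_div_iff_mul_le (by simp [Real.exp_pos]) (by simp), mul_comm]
  exact h

theorem nodeLaw_le_indexCount (n : ℕ) {B : Set (unitInterval × unitInterval)}
    (hB : MeasurableSet B) (b : ℝ) :
    nodeLaw n {ω | b ≤ indexCount B ω} ≤
      ENNReal.ofReal (Real.exp (2 * (n * volume.real B) - b)) := by
  have h := nodeLaw_exp_indexCount_ge n hB 1 b
  simp only [one_mul] at h
  refine h.trans (ENNReal.ofReal_le_ofReal (Real.exp_le_exp.2 ?_))
  -- The Chernoff parameter is 1 here and -1 in the lower tail, where 1 - e⁻¹ ≥ 1/2 is used.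
  have h3 : Real.exp 1 - 1 ≤ 2 := by linarith [Real.exp_one_lt_three]
  have : 0 ≤ n * volume.real B := by positivity
  nlinarith

theorem nodeLaw_indexCount_le (n : ℕ) {B : Set (unitInterval × unitInterval)}
    (hB : MeasurableSet B) :
    nodeLaw n {ω | (indexCount B ω : ℝ) ≤ n * volume.real B / 4} ≤
      ENNReal.ofReal (Real.exp (-(n * volume.real B / 4))) := by
  have h := nodeLaw_exp_indexCount_ge n hB (-1) (-(n * volume.real B / 4))
  simp only [neg_mul, one_mul, neg_le_neg_iff] at h
  refine h.trans (ENNReal.ofReal_le_ofReal (Real.exp_le_exp.2 ?_))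
  have h3 : Real.exp (-1) ≤ 1 / 2 := by
    rw [Real.exp_neg, one_div]
    exact inv_anti₀ two_pos (by linarith [Real.add_one_le_exp (1 : ℝ)])
  have : 0 ≤ n * volume.real B := by positivity
  nlinarith

/-- Almost surely the locations are distinct. -/
theorem ae_injective_nodeLaw (n : ℕ) : ∀ᵐ ω ∂(nodeLaw n), Function.Injective ω.2 := by
  have h : ∀ᵐ u ∂(Measure.infinitePi fun _ : ℕ =>
      (volume : Measure (unitInterval × unitInterval))), Function.Injective u := by
    have : ∀ i j : ℕ, i ≠ j → ∀ᵐ u ∂(Measure.infinitePi fun _ : ℕ =>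
      (volume : Measure (unitInterval × unitInterval))), u i ≠ u j := by
      intro i j hij
      have hmap := Measure.infinitePi_map_eval_prod
        (P := fun _ : ℕ => (volume : Measure (unitInterval × unitInterval))) hij
      have hd : MeasurableSet {z : (unitInterval × unitInterval) × (unitInterval × unitInterval) |
          z.1 = z.2} := measurableSet_eq_fun measurable_fst measurable_snd
      rw [ae_iff]
      simp only [ne_eq, not_not]
      have h0 : (Measure.infinitePi fun _ : ℕ =>
          (volume : Measure (unitInterval × unitInterval))).map (fun ω ↦ (ω i, ω j))
          {z | z.1 = z.2} = 0 := by
        rw [hmap, Measure.prod_apply hd]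
        simp only [lintegral_eq_zero_iff (measurable_measure_prodMk_left hd)]
        refine Filter.Eventually.of_forall fun x => ?_
        have : Prod.mk x ⁻¹' {z : (unitInterval × unitInterval) × (unitInterval × unitInterval) |
          z.1 = z.2} = {x} := by ext y; simp [eq_comm]
        dsimp only
        rw [this, ← Prod.mk.eta (p := x), ← Set.singleton_prod_singleton, Measure.volume_eq_prod,
          Measure.prod_prod, measure_singleton, zero_mul, Pi.zero_apply]
      rwa [Measure.map_apply (by fun_prop) hd] at h0
    have h2 := ae_all_iff.2 fun i => ae_all_iff.2 fun j => ae_all_iff.2 (this i j)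
    filter_upwards [h2] with u hu i j hij
    by_contra hne
    exact hu i j hne hij
  exact Measure.quasiMeasurePreserving_snd.ae h

end Nodes

/-! ### Areas of grid cells and torus discs. -/

section Regions

/-- The location in `[0, √n]²` of a point of the unit square. -/
def location (n : ℕ) (u : unitInterval × unitInterval) : Pt := (√n * (u.1 : ℝ), √n * (u.2 : ℝ))

theorem nodeSet_eq (n : ℕ) (ω : NodeSpace) :
    nodeSet n ω = (Finset.range ω.1).image fun i => location n (ω.2 i) := rfl

theorem location_injective {n : ℕ} (hn : 0 < n) : Function.Injective (location n) := by
  have hL : √(n : ℝ) ≠ 0 := (Real.sqrt_pos.2 (by exact_mod_cast hn)).ne'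
  intro u v h
  simp only [location, Prod.mk.injEq, mul_right_inj' hL] at h
  exact Prod.ext (Subtype.ext h.1) (Subtype.ext h.2)

theorem card_filter_nodeSet_le (n : ℕ) (ω : NodeSpace) (P : Pt → Prop)
    {B : Set (unitInterval × unitInterval)} (h : ∀ u, P (location n u) → u ∈ B) :
    ((nodeSet n ω).filter P).card ≤ indexCount B ω := by
  rw [nodeSet_eq, Finset.filter_image]
  refine Finset.card_image_le.trans (Finset.card_le_card ?_)
  exact Finset.monotone_filter_right _ fun i _ hi => h _ hi

/-- Repeated locations would collapse in the image defining `nodeSet`; only this direction needs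
them to be distinct. -/
theorem indexCount_le_card_filter_nodeSet {n : ℕ} (hn : 0 < n) {ω : NodeSpace}
    (hω : Function.Injective ω.2) (P : Pt → Prop)
    {B : Set (unitInterval × unitInterval)} (h : ∀ u ∈ B, P (location n u)) :
    indexCount B ω ≤ ((nodeSet n ω).filter P).card := by
  rw [nodeSet_eq, Finset.filter_image, Finset.card_image_of_injective]
  · exact Finset.card_le_card (Finset.monotone_filter_right _ fun i _ hi => h _ hi)
  · exact (location_injective hn).comp hω

theorem volume_coe_preimage_le (s : Set ℝ) (hs : MeasurableSet s) :
    volume ((fun u : unitInterval => (u : ℝ)) ⁻¹' s) ≤ volume s := by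
  rw [unitInterval.measurePreserving_coe.measure_preimage hs.nullMeasurableSet]
  exact Measure.restrict_apply_le _ _

/-- A cell of the division of the unit square into `M²` squares. -/
def cell (M i j : ℕ) : Set (unitInterval × unitInterval) :=
  ((fun u : unitInterval => (u : ℝ)) ⁻¹' Set.Ico ((i : ℝ) / M) ((i + 1) / M)) ×ˢ
    ((fun u : unitInterval => (u : ℝ)) ⁻¹' Set.Ico ((j : ℝ) / M) ((j + 1) / M))

theorem measurableSet_cell (M i j : ℕ) : MeasurableSet (cell M i j) :=
  (measurable_subtype_coe measurableSet_Ico).prod (measurable_subtype_coe measurableSet_Ico)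

theorem volume_coe_preimage_Ico {M i : ℕ} (hi : i < M) :
    volume ((fun u : unitInterval => (u : ℝ)) ⁻¹' Set.Ico ((i : ℝ) / M) ((i + 1) / M)) =
      ENNReal.ofReal (1 / M) := by
  have hM : (0 : ℝ) < M := by exact_mod_cast (Nat.zero_le i).trans_lt hi
  have hi' : (i : ℝ) + 1 ≤ M := by exact_mod_cast hi
  rw [unitInterval.measurePreserving_coe.measure_preimage measurableSet_Ico.nullMeasurableSet,
    Measure.restrict_apply measurableSet_Ico, Set.inter_eq_left.2, Real.volume_Ico]
  · congr 1; ring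
  · intro y hy
    exact ⟨le_trans (by positivity) hy.1, hy.2.le.trans ((div_le_one hM).2 hi')⟩

theorem volume_real_cell {M i j : ℕ} (hi : i < M) (hj : j < M) :
    volume.real (cell M i j) = 1 / (M : ℝ) ^ 2 := by
  rw [measureReal_def, cell, Measure.volume_eq_prod, Measure.prod_prod, volume_coe_preimage_Ico hi,
    volume_coe_preimage_Ico hj, ← ENNReal.ofReal_mul (by positivity),
    ENNReal.toReal_ofReal (by positivity)]
  ring

/-- The part of the unit square within torus distance `ρ` of `z`. -/
def discRegion (n : ℕ) (z : Pt) (ρ : ℝ) : Set (unitInterval × unitInterval) :=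
  {u | torusDist √n (location n u) z ≤ ρ}

theorem measurableSet_discRegion (n : ℕ) (z : Pt) (ρ : ℝ) : MeasurableSet (discRegion n z ρ) := by
  refine (IsClosed.measurableSet ?_)
  refine isClosed_le ?_ continuous_const
  unfold torusDist location
  have h : Continuous fun x : ℝ => ((x : ℝ) : AddCircle √(n : ℝ)) := AddCircle.continuous_mk' _
  fun_prop

theorem volume_arc_le {L q ρ : ℝ} (hL : 0 < L) (hρ : 0 ≤ ρ) (hq0 : 0 ≤ q) (hq1 : q ≤ L) :
    volume {u : unitInterval | ‖((L * u - q : ℝ) : AddCircle L)‖ ≤ ρ} ≤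
      ENNReal.ofReal (6 * ρ / L) := by
  -- Lifts of the arc to the line. Only m = -1, 0, 1 can meet the unit interval, each with length
  -- 2ρ/L.
  set J : ℤ → Set ℝ := fun m => Set.Icc ((q + m * L - ρ) / L) ((q + m * L + ρ) / L) with hJ
  have hsub : {u : unitInterval | ‖((L * u - q : ℝ) : AddCircle L)‖ ≤ ρ} ⊆
      (fun u : unitInterval => (u : ℝ)) ⁻¹' (J (-1) ∪ J 0 ∪ J 1) := by
    intro u hu
    have hu' : ‖((L * u - q : ℝ) : AddCircle L)‖ ≤ ρ := hu
    rw [AddCircle.norm_eq] at hu'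
    set m := round (L⁻¹ * (L * (u : ℝ) - q)) with hm
    have hu0 := u.2.1
    have hu1 := u.2.2
    have hb : |L⁻¹ * (L * (u : ℝ) - q)| ≤ 1 := by
      rw [abs_mul, abs_of_pos (inv_pos.2 hL), inv_mul_le_iff₀ hL, mul_one, abs_le]
      constructor <;> nlinarith
    have hmem : (u : ℝ) ∈ J m := by
      rw [abs_le] at hu'
      simp only [hJ, Set.mem_Icc]
      rw [div_le_iff₀ hL, le_div_iff₀ hL]
      constructor <;> linarith
    have h3 := abs_sub_round (L⁻¹ * (L * (u : ℝ) - q))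
    rw [← hm] at h3
    rw [abs_le] at h3 hb
    have hm1 : (-2 : ℤ) < m := by
      have : ((-2 : ℤ) : ℝ) < m := by push_cast; linarith
      exact_mod_cast this
    have hm2 : m < 2 := by
      have : (m : ℝ) < (2 : ℤ) := by push_cast; linarith
      exact_mod_cast this
    have : m = -1 ∨ m = 0 ∨ m = 1 := by omega
    simp only [Set.mem_preimage, Set.mem_union]
    rcases this with h | h | h <;> rw [h] at hmem <;> simp [hmem]
  have hJv : ∀ m, volume (J m) = ENNReal.ofReal (2 * ρ / L) := by
    intro m
    rw [hJ, Real.volume_Icc]; congr 1; ring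
  refine (measure_mono hsub).trans
    ((volume_coe_preimage_le _ (by simp only [hJ]; measurability)).trans ?_)
  refine (measure_union_le _ _).trans ((add_le_add_left (measure_union_le _ _) _).trans ?_)
  rw [hJv, hJv, hJv, ← ENNReal.ofReal_add (by positivity) (by positivity),
    ← ENNReal.ofReal_add (by positivity) (by positivity)]
  refine ENNReal.ofReal_le_ofReal (le_of_eq ?_)
  ring

theorem volume_discRegion_le {n : ℕ} (hn : 0 < n) {z : Pt} {ρ : ℝ} (hρ : 0 ≤ ρ)
    (hz1 : 0 ≤ z.1 ∧ z.1 ≤ √n) (hz2 : 0 ≤ z.2 ∧ z.2 ≤ √n) :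
    volume (discRegion n z ρ) ≤ ENNReal.ofReal (36 * ρ ^ 2 / n) := by
  have hL : 0 < √(n : ℝ) := Real.sqrt_pos.2 (by exact_mod_cast hn)
  have hsub : discRegion n z ρ ⊆
      {u : unitInterval | ‖((√n * u - z.1 : ℝ) : AddCircle √(n : ℝ))‖ ≤ ρ} ×ˢ
      {u : unitInterval | ‖((√n * u - z.2 : ℝ) : AddCircle √(n : ℝ))‖ ≤ ρ} := by
    intro u hu
    have hu' : torusDist √n (location n u) z ≤ ρ := hu
    rw [torusDist] at hu'
    have h1 := (Real.le_sqrt (norm_nonneg _) (by positivity)).2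
      (le_add_of_nonneg_right (a := ‖(((location n u).1 - z.1 : ℝ) : AddCircle √(n : ℝ))‖ ^ 2)
        (sq_nonneg ‖(((location n u).2 - z.2 : ℝ) : AddCircle √(n : ℝ))‖))
    have h2 := (Real.le_sqrt (norm_nonneg _) (by positivity)).2
      (le_add_of_nonneg_left (a := ‖(((location n u).2 - z.2 : ℝ) : AddCircle √(n : ℝ))‖ ^ 2)
        (sq_nonneg ‖(((location n u).1 - z.1 : ℝ) : AddCircle √(n : ℝ))‖))
    exact ⟨h1.trans hu', h2.trans hu'⟩
  refine (measure_mono hsub).trans ?_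
  rw [Measure.volume_eq_prod, Measure.prod_prod]
  refine (mul_le_mul' (volume_arc_le hL hρ hz1.1 hz1.2) (volume_arc_le hL hρ hz2.1 hz2.2)).trans ?_
  rw [← ENNReal.ofReal_mul (by positivity)]
  refine ENNReal.ofReal_le_ofReal (le_of_eq ?_)
  have : √(n : ℝ) * √n = n := Real.mul_self_sqrt (Nat.cast_nonneg n)
  rw [div_mul_div_comm, this]; ring

end Regions

/-! ### Evenly spread node configurations and their probability. -/

section Density

variable {c : ℝ} {n : ℕ} {ω : NodeSpace}

/-- The side of the finest grid that is used: its cells have side about an eighth of the local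
radius. -/
def gridSize (c : ℝ) (n : ℕ) : ℕ := ⌈8 * √n / localRadius c n⌉₊

/-- A corner of a cell of the finest grid. -/
def gridPoint (c : ℝ) (n i j : ℕ) : Pt :=
  (√n * (i / gridSize c n), √n * (j / gridSize c n))

/-- A node configuration that is as dense as expected, up to constant factors, on all squares and
discs that are not too small. -/
structure WellSpread (c : ℝ) (n : ℕ) (ω : NodeSpace) : Prop where
  injective : Function.Injective ω.2
  cell_lt : ∀ M ∈ Finset.Icc 1 (gridSize c n), ∀ i < M, ∀ j < M,
    (n : ℝ) / (4 * M ^ 2) < indexCount (cell M i j) ω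
  disc_lt : ∀ i < gridSize c n, ∀ j < gridSize c n,
    (indexCount (discRegion n (gridPoint c n i j) (9 * localRadius c n)) ω : ℝ) <
      6000 * localRadius c n ^ 2
  count_lt : (ω.1 : ℝ) < 4 * n

theorem exists_nat_div_le {M : ℕ} (hM : 0 < M) {v : ℝ} (h0 : 0 ≤ v) (h1 : v < 1) :
    ∃ i < M, (i : ℝ) / M ≤ v ∧ v < (i + 1) / M := by
  have hM' : (0 : ℝ) < M := by exact_mod_cast hM
  refine ⟨⌊v * M⌋₊, ?_, ?_, ?_⟩
  · rw [Nat.floor_lt (by positivity)]; nlinarith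
  · rw [div_le_iff₀ hM']; exact Nat.floor_le (by positivity)
  · rw [lt_div_iff₀ hM']; exact Nat.lt_floor_add_one _

theorem gridSize_pos (hn : 0 < n) (hR : 0 < localRadius c n) : 0 < gridSize c n :=
  Nat.ceil_pos.2 (div_pos (mul_pos (by norm_num) (Real.sqrt_pos.2 (by exact_mod_cast hn))) hR)

/-- The disc contains a grid cell of side at most ρ/2, so control of finitely many cells covers all
centres and radii. -/
theorem WellSpread.le_card_disc (h : WellSpread c n ω) (hn : 0 < n) (hR : 0 < localRadius c n)
    (z : Pt) {ρ : ℝ} (hρ : localRadius c n / 4 ≤ ρ) (hρL : ρ ≤ 2 * √n) :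
    ρ ^ 2 / 64 < ((nodeSet n ω).filter fun y => torusDist √n y z ≤ ρ).card := by
  have hL : 0 < √(n : ℝ) := Real.sqrt_pos.2 (by exact_mod_cast hn)
  have hρ0 : 0 < ρ := by linarith
  obtain ⟨w, hw1, hw2, hw⟩ := exists_representative hL z
  simp only [← hw]
  set M : ℕ := ⌈2 * √n / ρ⌉₊ with hMdef
  have hM : 0 < M := Nat.ceil_pos.2 (by positivity)
  have hM' : (0 : ℝ) < M := by exact_mod_cast hM
  have hMle : M ≤ gridSize c n := by
    -- The radius R/4 corresponds exactly to the finest grid: 2√n/(R/4) = 8√n/R.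
    refine Nat.ceil_mono ?_
    rw [div_le_div_iff₀ hρ0 hR]
    nlinarith
  have hM1 : 2 * √n / ρ ≤ M := Nat.le_ceil _
  have hM2 : (M : ℝ) < 2 * √n / ρ + 1 := Nat.ceil_lt_add_one (by positivity)
  have hside : √n / M ≤ ρ / 2 := by
    rw [div_le_iff₀ hρ0] at hM1
    rw [div_le_iff₀ hM']; linarith
  obtain ⟨i, hi, hi1, hi2⟩ := exists_nat_div_le hM (v := w.1 / √n) (div_nonneg hw1.1 hL.le)
    ((div_lt_one hL).2 hw1.2)
  obtain ⟨j, hj, hj1, hj2⟩ := exists_nat_div_le hM (v := w.2 / √n) (div_nonneg hw2.1 hL.le)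
    ((div_lt_one hL).2 hw2.2)
  have hcell := h.cell_lt M (Finset.mem_Icc.2 ⟨hM, hMle⟩) i hi j hj
  have close : ∀ (i : ℕ) (u v : ℝ), (i : ℝ) / M ≤ v / √n → v / √n < (i + 1) / M →
      (i : ℝ) / M ≤ u → u < (i + 1) / M → |√n * u - v| ≤ ρ / 2 := by
    intro i u v h1 h2 h3 h4
    have e : v = √n * (v / √n) := by field_simp
    have e2 : ((i : ℝ) + 1) / M = i / M + 1 / M := add_div _ _ _
    rw [e, ← mul_sub, abs_mul, abs_of_pos hL]
    have : |u - v / √n| ≤ 1 / M := by rw [abs_le]; constructor <;> linarith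
    calc √n * |u - v / √n| ≤ √n * (1 / M) := by gcongr
      _ = √n / M := by ring
      _ ≤ _ := hside
  have hcount := indexCount_le_card_filter_nodeSet hn h.injective
    (fun y => torusDist √n y w ≤ ρ) (B := cell M i j) (by
      intro u hu
      have := torusDist_le_of_abs_le (L := √n) (x := location n u) (y := w)
        (close i u.1 w.1 hi1 hi2 hu.1.1 hu.1.2) (close j u.2 w.2 hj1 hj2 hu.2.1 hu.2.2)
      linarith)
  have hcount' : (indexCount (cell M i j) ω : ℝ) ≤
      ((nodeSet n ω).filter fun y => torusDist √n y w ≤ ρ).card := by exact_mod_cast hcount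
  refine lt_of_le_of_lt ?_ (hcell.trans_le hcount')
  rw [div_le_div_iff₀ (by norm_num) (by positivity)]
  have hMρ : M * ρ ≤ 4 * √n := by
    have : 1 ≤ 2 * √n / ρ := (one_le_div hρ0).2 hρL
    have : (M : ℝ) ≤ 4 * √n / ρ := by
      have e : 4 * √n / ρ = 2 * √n / ρ + 2 * √n / ρ := by ring
      linarith
    rwa [le_div_iff₀ hρ0] at this
  have hsq := pow_le_pow_left₀ (by positivity) hMρ 2
  have hn' : √(n : ℝ) ^ 2 = n := Real.sq_sqrt (Nat.cast_nonneg n)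
  nlinarith

theorem WellSpread.hasCloserContacts (h : WellSpread c n ω) (hn : 0 < n)
    (hR : 0 < localRadius c n) (hRn : localRadius c n ≤ √n) (t : Pt) :
    HasCloserContacts c n (nodeSet n ω) t := by
  intro x _ hxt
  -- Any node within R/4 of the point R/2 ahead is within 3R/4 of `x` and at least R/4 closer to
  -- `t`.
  obtain ⟨z, hz1, hz2⟩ := exists_torusDist_toward (L := √n) (h := localRadius c n / 2) (x := x)
    (t := t) (by linarith) (by linarith) (by linarith)
  have hcard := h.le_card_disc hn hR z le_rfl (by linarith)
  have hpos : 0 < ((nodeSet n ω).filter fun y => torusDist √n y z ≤ localRadius c n / 4).card := by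
    have : (0 : ℝ) < ((nodeSet n ω).filter
      fun y => torusDist √n y z ≤ localRadius c n / 4).card := lt_of_le_of_lt (by positivity) hcard
    exact_mod_cast this
  obtain ⟨y, hy⟩ := Finset.card_pos.1 hpos
  obtain ⟨hyV, hyz⟩ := Finset.mem_filter.1 hy
  have h1 := torusDist_triangle √n x z y
  have h2 := torusDist_triangle √n y z t
  rw [torusDist_comm √n z y] at h1
  exact ⟨y, hyV, by linarith, by linarith⟩

theorem WellSpread.hasAnnulusShortcuts (h : WellSpread c n ω) (hn : 0 < n)
    (hR : 1 ≤ localRadius c n) {a b : ℝ} (hb : 0 ≤ b) (hb1 : b ≤ 1) (hba : b ≤ a) (t : Pt) :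
    HasAnnulusShortcuts c n a (nodeSet n ω) t (b / 50000) := by
  intro x _ r hr hrL hxr hxr'
  have hL : 0 < √(n : ℝ) := Real.sqrt_pos.2 (by exact_mod_cast hn)
  -- 5/16 is midway between 1/4 and 3/8, and 1/17 < 1/16, so the disc lies in the inner part of the
  -- annulus. Its points are farther than r/2 - 3r/8 = r/8 > R from `x`, so shortcuts to them are
  -- allowed.
  have hz := torusDist_horizontal (h := 5 * r / 16) hL (by linarith) (by linarith) t
  set z : Pt := (t.1 + 5 * r / 16, t.2) with hzdef
  have hcard := h.le_card_disc hn (by linarith) z (ρ := r / 17) (by linarith) (by linarith)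
  set D := (nodeSet n ω).filter fun y => torusDist √n y z ≤ r / 17 with hD
  have hDt : ∀ y ∈ D, r / 4 < torusDist √n y t ∧ torusDist √n y t < 3 * r / 8 := by
    intro y hy
    have hyz := (Finset.mem_filter.1 hy).2
    have h1 := torusDist_triangle √n y z t
    have h2 := torusDist_triangle √n z y t
    rw [torusDist_comm √n z y] at h2
    constructor <;> linarith
  have hprob : ∀ y ∈ D, b * 4 / (9 * r ^ 2) ≤ shortcutProb c n a x y := by
    intro y hy
    obtain ⟨hy1, hy2⟩ := hDt y hy
    have h1 := torusDist_triangle √n x y t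
    have h2 := torusDist_triangle √n x t y
    rw [torusDist_comm √n t y] at h2
    have hfar : localRadius c n < torusDist √n x y := by linarith
    have hd0 : 0 < torusDist √n x y := by linarith
    have hd : torusDist √n x y ≤ 3 * r / 2 := by linarith
    rw [shortcutProb, if_pos hfar]
    have hsq := pow_le_pow_left₀ hd0.le hd 2
    refine le_min ?_ ?_
    · rw [div_le_div_iff₀ (by nlinarith) (by positivity)]
      nlinarith
    · rw [div_le_one (by nlinarith)]
      nlinarith
  have hp0 : ∀ y, 0 ≤ shortcutProb c n a x y := fun y =>
    pairProb_nonneg (c := c) (n := n) (hb.trans hba) s(x, y)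
  have hr0 : 0 < r := by linarith
  calc b / 50000 ≤ ((r / 17) ^ 2 / 64) * (b * 4 / (9 * r ^ 2)) := by
        have : ((r / 17) ^ 2 / 64) * (b * 4 / (9 * r ^ 2)) = b / 41616 := by
          field_simp; ring
        rw [this]
        exact div_le_div_of_nonneg_left hb (by norm_num) (by norm_num)
    _ ≤ D.card * (b * 4 / (9 * r ^ 2)) := by gcongr
    _ = ∑ y ∈ D, b * 4 / (9 * r ^ 2) := by rw [Finset.sum_const, nsmul_eq_mul]
    _ ≤ ∑ y ∈ D, shortcutProb c n a x y := Finset.sum_le_sum hprob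
    _ ≤ _ := by
        refine Finset.sum_le_sum_of_subset_of_nonneg ?_ fun y _ _ => hp0 y
        intro y hy
        obtain ⟨hy1, hy2⟩ := hDt y hy
        exact Finset.mem_filter.2 ⟨(Finset.mem_filter.1 hy).1, hy1, by linarith⟩

theorem WellSpread.card_near_le (h : WellSpread c n ω) (hn : 0 < n)
    (hR : 0 < localRadius c n) (t : Pt) :
    ((nodeSet n ω).filter fun y => torusDist √n y t ≤ 8 * localRadius c n).card ≤
      ⌈6000 * localRadius c n ^ 2⌉₊ := by
  have hL : 0 < √(n : ℝ) := Real.sqrt_pos.2 (by exact_mod_cast hn)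
  obtain ⟨w, hw1, hw2, hw⟩ := exists_representative hL t
  have hM := gridSize_pos hn hR
  have hM' : (0 : ℝ) < gridSize c n := by exact_mod_cast hM
  have hside : √n * (1 / gridSize c n) ≤ localRadius c n / 2 := by
    have h1 : 8 * √n / localRadius c n ≤ gridSize c n := Nat.le_ceil _
    rw [div_le_iff₀ hR] at h1
    rw [mul_one_div, div_le_iff₀ hM']
    linarith
  obtain ⟨i, hi, hi1, hi2⟩ := exists_nat_div_le hM (v := w.1 / √n) (div_nonneg hw1.1 hL.le)
    ((div_lt_one hL).2 hw1.2)
  obtain ⟨j, hj, hj1, hj2⟩ := exists_nat_div_le hM (v := w.2 / √n) (div_nonneg hw2.1 hL.le)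
    ((div_lt_one hL).2 hw2.2)
  have close : ∀ (i : ℕ) (v : ℝ), (i : ℝ) / gridSize c n ≤ v / √n →
      v / √n < (i + 1) / gridSize c n → |v - √n * (i / gridSize c n)| ≤ localRadius c n / 2 := by
    intro i v h1 h2
    have e : v = √n * (v / √n) := by field_simp
    rw [e, ← mul_sub, abs_mul, abs_of_pos hL, abs_of_nonneg (by linarith)]
    rw [add_div] at h2
    refine le_trans ?_ hside
    gcongr
    linarith
  have hwg := torusDist_le_of_abs_le (L := √n) (x := w) (y := gridPoint c n i j)
    (close i w.1 hi1 hi2) (close j w.2 hj1 hj2)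
  -- A grid point lies within R of the centre, whence the radius 9R in `disc_lt`.
  have hcount := card_filter_nodeSet_le n ω (fun y => torusDist √n y t ≤ 8 * localRadius c n)
    (B := discRegion n (gridPoint c n i j) (9 * localRadius c n)) (by
      intro u hu
      rw [← hw] at hu
      have := torusDist_triangle √n (location n u) w (gridPoint c n i j)
      exact this.trans (by linarith))
  refine hcount.trans ?_
  have := (h.disc_lt i hi j hj).le.trans (Nat.le_ceil _)
  exact_mod_cast this

theorem WellSpread.card_nodeSet_le (h : WellSpread c n ω) : ((nodeSet n ω).card : ℝ) ≤ 4 * n := by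
  have : (nodeSet n ω).card ≤ ω.1 := Finset.card_image_le.trans_eq (Finset.card_range _)
  exact le_trans (by exact_mod_cast this) h.count_lt.le

theorem nodeLaw_not_wellSpread_le (hn : 81 ≤ n) (hc : 1296 ≤ c) (hR : 1 ≤ localRadius c n)
    (hRn : localRadius c n ≤ √n) :
    nodeLaw n {ω | ¬ WellSpread c n ω} ≤ ENNReal.ofReal (3 / n) := by
  have hn0 : 0 < n := by omega
  have hn' : (0 : ℝ) < n := by exact_mod_cast hn0
  have hL : 0 < √(n : ℝ) := Real.sqrt_pos.2 hn'
  have hLn : √(n : ℝ) ^ 2 = n := Real.sq_sqrt hn'.le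
  have hR0 : 0 < localRadius c n := by linarith
  have hlog : 0 ≤ Real.log n := Real.log_natCast_nonneg n
  have hRsq : localRadius c n ^ 2 = c * Real.log n := Real.sq_sqrt (by positivity)
  have hexp : Real.exp (Real.log n) = n := Real.exp_log hn'
  set M₀ := gridSize c n with hM₀
  have hMpos : 0 < M₀ := gridSize_pos hn0 hR0
  have hMR : M₀ * localRadius c n ≤ 9 * √n := by
    have h1 : (M₀ : ℝ) < 8 * √n / localRadius c n + 1 := Nat.ceil_lt_add_one (by positivity)
    have h2 : 8 * √n / localRadius c n * localRadius c n = 8 * √n := by field_simp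
    nlinarith
  have hL9 : 9 ≤ √(n : ℝ) := by
    rw [show (9 : ℝ) = √81 by rw [show (81 : ℝ) = 9 ^ 2 by norm_num, Real.sqrt_sq (by norm_num)]]
    exact Real.sqrt_le_sqrt (by exact_mod_cast hn)
  have hMn : (M₀ : ℝ) ≤ n := by nlinarith [(Nat.cast_nonneg M₀ : (0 : ℝ) ≤ M₀)]
  have hMn' : M₀ ≤ n := by exact_mod_cast hMn
  set I₁ : Finset (ℕ × ℕ × ℕ) := (Finset.Icc 1 M₀ ×ˢ Finset.range M₀ ×ˢ Finset.range M₀).filter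
    fun m => m.2.1 < m.1 ∧ m.2.2 < m.1 with hI₁
  set I₂ : Finset (ℕ × ℕ) := Finset.range M₀ ×ˢ Finset.range M₀ with hI₂
  set E₁ : ℕ × ℕ × ℕ → Set NodeSpace := fun m =>
    {ω | (indexCount (cell m.1 m.2.1 m.2.2) ω : ℝ) ≤ n * volume.real (cell m.1 m.2.1 m.2.2) / 4}
    with hE₁
  set E₂ : ℕ × ℕ → Set NodeSpace := fun m =>
    {ω | 6000 * localRadius c n ^ 2 ≤
      (indexCount (discRegion n (gridPoint c n m.1 m.2) (9 * localRadius c n)) ω : ℝ)} with hE₂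
  set E₃ : Set NodeSpace := {ω | 4 * (n : ℝ) ≤ indexCount Set.univ ω} with hE₃
  have hsub : {ω | ¬ WellSpread c n ω} ⊆ {ω : NodeSpace | ¬ Function.Injective ω.2} ∪
      ((⋃ m ∈ I₁, E₁ m) ∪ ((⋃ m ∈ I₂, E₂ m) ∪ E₃)) := by
    intro ω hω
    by_contra hcon
    simp only [Set.mem_union, not_or, Set.mem_iUnion, not_exists] at hcon
    obtain ⟨h0, h1, h2, h3⟩ := hcon
    refine hω ⟨by simpa using h0, ?_, ?_, ?_⟩
    · intro M hM i hi j hj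
      have hMM := (Finset.mem_Icc.1 hM).2
      have hmem : (M, i, j) ∈ I₁ := by
        simp only [hI₁, hI₂, Finset.mem_filter, Finset.mem_product, Finset.mem_range]
        exact ⟨⟨hM, hi.trans_le hMM, hj.trans_le hMM⟩, hi, hj⟩
      have := h1 _ hmem
      simp only [hE₁, Set.mem_ofPred_eq, not_le] at this
      rw [volume_real_cell hi hj] at this
      refine lt_of_eq_of_lt ?_ this
      field_simp
    · intro i hi j hj
      have := h2 (i, j) (Finset.mk_mem_product (Finset.mem_range.2 hi) (Finset.mem_range.2 hj))
      simpa only [hE₂, Set.mem_ofPred_eq, not_le] using this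
    · simpa [hE₃, indexCount] using h3
  have hb₁ : ∀ m ∈ I₁, nodeLaw n (E₁ m) ≤ ENNReal.ofReal (Real.exp (-(4 * Real.log n))) := by
    rintro ⟨M, i, j⟩ hm
    simp only [hI₁, Finset.mem_filter, Finset.mem_product, Finset.mem_Icc] at hm
    obtain ⟨⟨⟨hM1, hM2⟩, -⟩, hi, hj⟩ := hm
    refine (nodeLaw_indexCount_le n (measurableSet_cell M i j)).trans
      (ENNReal.ofReal_le_ofReal (Real.exp_le_exp.2 (neg_le_neg ?_)))
    rw [volume_real_cell hi hj, mul_one_div]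
    have hMp : (0 : ℝ) < M := by exact_mod_cast hM1
    have hMM : (M : ℝ) ≤ M₀ := by exact_mod_cast hM2
    have h1 : M * localRadius c n ≤ 9 * √n :=
      (mul_le_mul_of_nonneg_right hMM hR0.le).trans hMR
    have h2 := pow_le_pow_left₀ (by positivity) h1 2
    rw [mul_pow, mul_pow, hLn, hRsq] at h2
    rw [le_div_iff₀ (by norm_num), le_div_iff₀ (by positivity)]
    -- The threshold is 1296 = 4 · 4 · 81: the exponent n/(4M²) is at least c log n/(4 · 81), and 4
    -- log n is needed to beat n³ cells.
    have h3 : 1296 * Real.log n * M ^ 2 ≤ c * Real.log n * M ^ 2 := by gcongr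
    nlinarith
  have hb₂ : ∀ m ∈ I₂, nodeLaw n (E₂ m) ≤ ENNReal.ofReal (Real.exp (-(4 * Real.log n))) := by
    rintro ⟨i, j⟩ hm
    simp only [hI₂, Finset.mem_product, Finset.mem_range] at hm
    refine (nodeLaw_le_indexCount n (measurableSet_discRegion _ _ _) _).trans
      (ENNReal.ofReal_le_ofReal (Real.exp_le_exp.2 ?_))
    have hfrac : ∀ i < M₀, 0 ≤ √n * ((i : ℝ) / M₀) ∧ √n * ((i : ℝ) / M₀) ≤ √n := by
      intro i hi
      refine ⟨by positivity, mul_le_of_le_one_right hL.le ?_⟩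
      rw [div_le_one (by exact_mod_cast hMpos)]
      exact_mod_cast hi.le
    have hv := volume_discRegion_le hn0 (z := gridPoint c n i j) (ρ := 9 * localRadius c n)
      (by positivity) (hfrac i hm.1) (hfrac j hm.2)
    have hv' := ENNReal.toReal_mono ENNReal.ofReal_ne_top hv
    rw [ENNReal.toReal_ofReal (by positivity), ← measureReal_def] at hv'
    have h1 := mul_le_mul_of_nonneg_left hv' hn'.le
    -- The upper tail costs twice this mean bound, 5832R² < 6000R².
    have h2 : (n : ℝ) * (36 * (9 * localRadius c n) ^ 2 / n) = 2916 * localRadius c n ^ 2 := by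
      field_simp; norm_num
    have h3 : 1296 * Real.log n ≤ localRadius c n ^ 2 := by
      rw [hRsq]; gcongr
    dsimp only
    linarith
  have hb₃ : nodeLaw n E₃ ≤ ENNReal.ofReal (1 / n) := by
    refine (nodeLaw_le_indexCount n MeasurableSet.univ _).trans (ENNReal.ofReal_le_ofReal ?_)
    rw [probReal_univ, one_div, ← hexp, ← Real.exp_neg, Real.exp_le_exp]
    rw [hexp]
    have := Real.log_le_self hn'.le
    linarith
  have hfin : ∀ (N : ℕ), N ≤ n ^ 3 → N * ENNReal.ofReal (Real.exp (-(4 * Real.log n))) ≤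
      ENNReal.ofReal (1 / n) := by
    intro N hN
    rw [← ENNReal.ofReal_natCast, ← ENNReal.ofReal_mul (by positivity)]
    refine ENNReal.ofReal_le_ofReal ?_
    have h1 : Real.exp (-(4 * Real.log n)) = ((n : ℝ) ^ 4)⁻¹ := by
      rw [Real.exp_neg, show (4 : ℝ) * Real.log n = (4 : ℕ) * Real.log n by norm_num,
        Real.exp_nat_mul, hexp]
    have h2 : (N : ℝ) ≤ n ^ 3 := by exact_mod_cast hN
    rw [h1, ← div_eq_mul_inv, div_le_div_iff₀ (by positivity) hn']
    calc (N : ℝ) * n ≤ n ^ 3 * n := by gcongr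
      _ = _ := by ring
  have hu₁ : nodeLaw n (⋃ m ∈ I₁, E₁ m) ≤ ENNReal.ofReal (1 / n) := by
    refine (measure_biUnion_finset_le _ _).trans ((Finset.sum_le_sum hb₁).trans ?_)
    rw [Finset.sum_const, nsmul_eq_mul]
    refine hfin _ ((Finset.card_filter_le _ _).trans ?_)
    simp only [Finset.card_product, Nat.card_Icc, Finset.card_range, Nat.add_sub_cancel]
    calc M₀ * (M₀ * M₀) ≤ n * (n * n) := by gcongr
      _ = n ^ 3 := by ring
  have hu₂ : nodeLaw n (⋃ m ∈ I₂, E₂ m) ≤ ENNReal.ofReal (1 / n) := by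
    refine (measure_biUnion_finset_le _ _).trans ((Finset.sum_le_sum hb₂).trans ?_)
    rw [Finset.sum_const, nsmul_eq_mul]
    refine hfin _ ?_
    simp only [hI₂, Finset.card_product, Finset.card_range]
    calc M₀ * M₀ ≤ n * n := by gcongr
      _ ≤ n * n * n := Nat.le_mul_of_pos_right _ hn0
      _ = n ^ 3 := by ring
  have h0 : nodeLaw n {ω : NodeSpace | ¬ Function.Injective ω.2} = 0 :=
    ae_iff.1 (ae_injective_nodeLaw n)
  calc _ ≤ _ := measure_mono hsub
    _ ≤ nodeLaw n {ω : NodeSpace | ¬ Function.Injective ω.2} + (nodeLaw n (⋃ m ∈ I₁, E₁ m) +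
        (nodeLaw n (⋃ m ∈ I₂, E₂ m) + nodeLaw n E₃)) := by
      refine (measure_union_le _ _).trans (add_le_add le_rfl ?_)
      refine (measure_union_le _ _).trans (add_le_add le_rfl ?_)
      exact measure_union_le _ _
    _ ≤ 0 + (ENNReal.ofReal (1 / n) + (ENNReal.ofReal (1 / n) + ENNReal.ofReal (1 / n))) := by
      rw [h0]; gcongr
    _ = _ := by
      rw [zero_add, ← ENNReal.ofReal_add (by positivity) (by positivity),
        ← ENNReal.ofReal_add (by positivity) (by positivity)]
      congr 1; ring

end Density

/-! ### A lower bound of order 1/log n for the normalising constant. -/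

section Normalization

variable {c : ℝ} {n : ℕ} {a : ℝ}

theorem pos_of_expectedShortcuts_eq_one {x : Pt} (h : expectedShortcuts c n a x = 1) : 0 < a := by
  by_contra! ha
  have h0 : ∀ v, ENNReal.ofReal (shortcutProb c n a x v) = 0 := by
    intro v
    rw [ENNReal.ofReal_eq_zero, shortcutProb]
    split_ifs
    · exact (min_le_left _ _).trans (div_nonpos_of_nonpos_of_nonneg ha (sq_nonneg _))
    · exact le_rfl
  simp [expectedShortcuts, h0] at h

/-- Decomposition of the shortcut probability over dyadic discs. -/
theorem shortcutProb_le_sum_indicator (ha : 0 ≤ a) (hn : 0 < n) (hR : 0 < localRadius c n) {J : ℕ}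
    (hJ : √n < 2 ^ J * localRadius c n) (x : Pt) (u : unitInterval × unitInterval) :
    ENNReal.ofReal (shortcutProb c n a x (location n u)) ≤
      ∑ j ∈ Finset.range J, (discRegion n x (2 ^ (j + 1) * localRadius c n)).indicator
        (fun _ => ENNReal.ofReal (a / (2 ^ j * localRadius c n) ^ 2)) u := by
  have hL : 0 < √(n : ℝ) := Real.sqrt_pos.2 (by exact_mod_cast hn)
  rw [shortcutProb]
  split_ifs with h
  · set d := torusDist √n x (location n u) with hd
    obtain ⟨j, hj1, hj2⟩ := exists_nat_pow_near ((one_le_div hR).2 h.le) one_lt_two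
    rw [le_div_iff₀ hR] at hj1
    rw [div_lt_iff₀ hR] at hj2
    have hjJ : j < J := by
      have h1 : (2 : ℝ) ^ j * localRadius c n < 2 ^ J * localRadius c n :=
        hj1.trans_lt ((torusDist_le_period hL _ _).trans_lt hJ)
      exact (pow_lt_pow_iff_right₀ one_lt_two).1 (lt_of_mul_lt_mul_right h1 hR.le)
    have hmem : u ∈ discRegion n x (2 ^ (j + 1) * localRadius c n) := by
      change torusDist √n (location n u) x ≤ _
      rw [torusDist_comm]; exact hj2.le
    refine le_trans ?_ (Finset.single_le_sum (fun _ _ => zero_le) (Finset.mem_range.2 hjJ))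
    rw [Set.indicator_of_mem hmem]
    refine ENNReal.ofReal_le_ofReal ((min_le_left _ _).trans ?_)
    gcongr
  · simp

/-- The inverse square law is scale invariant in the plane: each dyadic scale contributes at most 36
· 4 · a = 144a expected shortcuts, and at most 2 log n scales suffice. -/
theorem one_le_of_expectedShortcuts_eq_one (hn : 3 ≤ n) (hR : 1 ≤ localRadius c n)
    (h : expectedShortcuts c n a (0, 0) = 1) : 1 ≤ 288 * a * Real.log n := by
  have ha := pos_of_expectedShortcuts_eq_one h
  have hn0 : 0 < n := by omega
  have hn' : (0 : ℝ) < n := by exact_mod_cast hn0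
  have hL : 0 < √(n : ℝ) := Real.sqrt_pos.2 hn'
  have hR0 : 0 < localRadius c n := by linarith
  have hlog : 1 ≤ Real.log n := by
    rw [Real.le_log_iff_exp_le hn']
    exact Real.exp_one_lt_three.le.trans (by exact_mod_cast hn)
  -- Enough scales to reach √n, because log 2 > 1/2.
  set J := ⌈Real.log n⌉₊ with hJdef
  have hJ1 : Real.log n ≤ J := Nat.le_ceil _
  have hJ2 : (J : ℝ) < Real.log n + 1 := Nat.ceil_lt_add_one (by linarith)
  have hJ : √n < 2 ^ J * localRadius c n := by
    have h1 : √(n : ℝ) = Real.exp (Real.log n / 2) := by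
      rw [Real.exp_half, Real.exp_log hn']
    have h2 : (2 : ℝ) ^ J = Real.exp (J * Real.log 2) := by
      rw [Real.exp_nat_mul, Real.exp_log two_pos]
    have h3 : √(n : ℝ) < 2 ^ J := by
      rw [h1, h2, Real.exp_lt_exp]
      nlinarith [Real.log_two_gt_d9]
    nlinarith [pow_pos (two_pos : (0 : ℝ) < 2) J]
  set g : unitInterval × unitInterval → ℝ≥0∞ := fun u =>
    ∑ j ∈ Finset.range J, (discRegion n (0, 0) (2 ^ (j + 1) * localRadius c n)).indicator
        (fun _ => ENNReal.ofReal (a / (2 ^ j * localRadius c n) ^ 2)) u with hg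
  have hgm : Measurable g := Finset.measurable_fun_sum _ fun j _ =>
    measurable_const.indicator (measurableSet_discRegion _ _ _)
  have h1 : (1 : ℝ≥0∞) ≤ n * ∫⁻ u, g u := by
    rw [← h, ← lintegral_nodeLaw_sum n hgm, expectedShortcuts]
    refine lintegral_mono fun ω => ?_
    rw [nodeSet_eq]
    refine (Finset.sum_image_le_of_nonneg (by simp)).trans ?_
    exact Finset.sum_le_sum fun i _ => shortcutProb_le_sum_indicator ha.le hn0 hR0 hJ _ _
  have h2 : ∫⁻ u, g u ≤ ENNReal.ofReal (J * (144 * a / n)) := by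
    rw [hg, lintegral_finsetSum _ fun j _ =>
      measurable_const.indicator (measurableSet_discRegion _ _ _)]
    have hterm : ∀ j ∈ Finset.range J,
        ∫⁻ u, (discRegion n (0, 0) (2 ^ (j + 1) * localRadius c n)).indicator
          (fun _ => ENNReal.ofReal (a / (2 ^ j * localRadius c n) ^ 2)) u ≤
        ENNReal.ofReal (144 * a / n) := by
      intro j _
      rw [lintegral_indicator_const (measurableSet_discRegion _ _ _)]
      refine (mul_le_mul' le_rfl (volume_discRegion_le hn0 (by positivity)
        ⟨le_rfl, hL.le⟩ ⟨le_rfl, hL.le⟩)).trans ?_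
      rw [← ENNReal.ofReal_mul (by positivity)]
      refine ENNReal.ofReal_le_ofReal (le_of_eq ?_)
      field_simp
      ring
    refine (Finset.sum_le_sum hterm).trans ?_
    rw [Finset.sum_const, Finset.card_range, nsmul_eq_mul, ENNReal.ofReal_mul (by positivity),
      ENNReal.ofReal_natCast]
  have h3 : (1 : ℝ≥0∞) ≤ ENNReal.ofReal (n * (J * (144 * a / n))) := by
    rw [ENNReal.ofReal_mul hn'.le, ENNReal.ofReal_natCast]
    exact h1.trans (mul_le_mul' le_rfl h2)
  rw [ENNReal.one_le_ofReal] at h3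
  have h4 : n * (J * (144 * a / n)) = 144 * a * J := by field_simp
  rw [h4] at h3
  nlinarith

end Normalization

/-! ### Choice of constants and passage to the limit. -/

section Limit

variable {c : ℝ} {n : ℕ} {a : ℝ}

theorem graphProb_le_one (ha : 0 ≤ a) (E : Finset Pt → Finset (Sym2 Pt) → Prop) :
    graphProb c n a E ≤ 1 := by
  unfold graphProb
  calc _ ≤ ∫⁻ _, 1 ∂(nodeLaw n) := lintegral_mono fun ω =>
        ENNReal.ofReal_le_one.2 (sum_shortcutWeight_le_one ha _ _)
    _ = 1 := by simp

/-- A lower bound for a lower integral: the integrand need not be measurable. -/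
theorem mul_one_sub_le_lintegral {Ω : Type*} [MeasurableSpace Ω] (μ : Measure Ω)
    [IsProbabilityMeasure μ] {f : Ω → ℝ≥0∞} {B : Set Ω} {b δ : ℝ≥0∞} (hB : μ B ≤ δ)
    (hf : ∀ ω ∉ B, b ≤ f ω) : b * (1 - δ) ≤ ∫⁻ ω, f ω ∂μ := by
  have hm : MeasurableSet (toMeasurable μ B)ᶜ := (measurableSet_toMeasurable μ B).compl
  calc b * (1 - δ) ≤ b * μ (toMeasurable μ B)ᶜ := by
        rw [prob_compl_eq_one_sub (measurableSet_toMeasurable μ B), measure_toMeasurable]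
        gcongr
    _ = ∫⁻ ω, (toMeasurable μ B)ᶜ.indicator (fun _ => b) ω ∂μ :=
        (lintegral_indicator_const hm b).symm
    _ ≤ _ := lintegral_mono fun ω => by
        by_cases h : ω ∈ (toMeasurable μ B)ᶜ
        · rw [Set.indicator_of_mem h]
          exact hf ω fun hB => h (subset_toMeasurable μ B hB)
        · rw [Set.indicator_of_notMem h]; exact zero_le

theorem one_add_exp_neg_div_two_pow_le {q : ℝ} (hq0 : 0 ≤ q) (hq1 : q ≤ 1) (k : ℕ) :
    ((1 + Real.exp (-q)) / 2) ^ k ≤ Real.exp (-(q * k / 4)) := by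
  have h1 : Real.exp (-q) ≤ 1 - q / 2 := by
    have h2 : Real.exp (-q) ≤ 1 / (1 + q) := by
      rw [Real.exp_neg, one_div]
      exact inv_anti₀ (by linarith) (by linarith [Real.add_one_le_exp q])
    refine h2.trans ?_
    rw [div_le_iff₀ (by linarith)]
    nlinarith
  have h3 : (1 + Real.exp (-q)) / 2 ≤ Real.exp (-(q / 4)) := by
    linarith [Real.add_one_le_exp (-(q / 4))]
  calc _ ≤ Real.exp (-(q / 4)) ^ k := pow_le_pow_left₀ (by positivity) h3 k
    _ = _ := by rw [← Real.exp_nat_mul]; congr 1; ring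

/-- The bound on the number of hops is `hopConstant c * log² n`. -/
def hopConstant (c : ℝ) : ℝ := 64 * 50000 * 288 + 30000 * c + 11

theorem le_graphProb_delivered {next : View → Pt} (hnext : IsApproxGreedy n next) (hn : 81 ≤ n)
    (hc : 1296 ≤ c) (hRn : localRadius c n ≤ √n)
    (h : expectedShortcuts c n a (0, 0) = 1) :
    ENNReal.ofReal (1 - 16 / n) * (1 - ENNReal.ofReal (3 / n)) ≤
      graphProb c n a fun V S => ∀ s ∈ V, ∀ t ∈ V,
        DeliveredWithin c n next V S s t (hopConstant c * Real.log n ^ 2) := by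
  have hn0 : 0 < n := by omega
  have hn' : (0 : ℝ) < n := by exact_mod_cast hn0
  have hn1 : (1 : ℝ) ≤ n := by exact_mod_cast hn0
  have hlog : 1 ≤ Real.log n := by
    rw [Real.le_log_iff_exp_le hn']
    exact Real.exp_one_lt_three.le.trans (by exact_mod_cast (by omega : 3 ≤ n))
  have hRsq : localRadius c n ^ 2 = c * Real.log n := Real.sq_sqrt (by positivity)
  have hR : 1 ≤ localRadius c n := by
    rw [localRadius, Real.one_le_sqrt]; nlinarith
  have ha := pos_of_expectedShortcuts_eq_one h
  have hab := one_le_of_expectedShortcuts_eq_one (by omega) hR h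
  set b : ℝ := 1 / (288 * Real.log n) with hb
  have hb0 : 0 < b := by positivity
  have hb1 : b ≤ 1 := by rw [hb, div_le_one (by positivity)]; linarith
  have hba : b ≤ a := by
    rw [hb, div_le_iff₀ (by positivity)]; linarith
  -- With q = b/50000 = 1/(50000 · 288 log n), this makes qk/4 at least 16 log n, more than the 4
  -- log n required.
  set k : ℕ := ⌈64 * 50000 * 288 * Real.log n ^ 2⌉₊ with hk
  have hk1 : 64 * 50000 * 288 * Real.log n ^ 2 ≤ k := Nat.le_ceil _
  have hk2 : (k : ℝ) < 64 * 50000 * 288 * Real.log n ^ 2 + 1 := Nat.ceil_lt_add_one (by positivity)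
  set N : ℕ := ⌈6000 * localRadius c n ^ 2⌉₊ with hN
  have hN2 : (N : ℝ) < 6000 * (c * Real.log n) + 1 := by
    rw [← hRsq]; exact Nat.ceil_lt_add_one (by positivity)
  have hK : ((k + (5 * N + 5) : ℕ) : ℝ) ≤ hopConstant c * Real.log n ^ 2 := by
    push_cast
    have hl2 : Real.log n ≤ Real.log n ^ 2 := by nlinarith
    have hl3 : c * Real.log n ≤ c * Real.log n ^ 2 := by gcongr
    rw [hopConstant]
    linarith
  have hpow : ((1 + Real.exp (-(b / 50000))) / 2) ^ k ≤ ((n : ℝ) ^ 4)⁻¹ := by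
    refine (one_add_exp_neg_div_two_pow_le (by positivity) (by linarith) k).trans ?_
    have hexp : ((n : ℝ) ^ 4)⁻¹ = Real.exp (-(4 * Real.log n)) := by
      rw [Real.exp_neg, show (4 : ℝ) * Real.log n = (4 : ℕ) * Real.log n by norm_num,
        Real.exp_nat_mul, Real.exp_log hn']
    rw [hexp, Real.exp_le_exp, neg_le_neg_iff]
    have h1 : b / 50000 * (64 * 50000 * 288 * Real.log n ^ 2) / 4 = 16 * Real.log n := by
      rw [hb]; field_simp; norm_num
    have h2 : b / 50000 * (64 * 50000 * 288 * Real.log n ^ 2) ≤ b / 50000 * k := by gcongr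
    linarith
  refine mul_one_sub_le_lintegral (nodeLaw n) (nodeLaw_not_wellSpread_le hn hc hR hRn) ?_
  intro ω hω
  have hω' : WellSpread c n ω := by simpa using hω
  refine ENNReal.ofReal_le_ofReal ?_
  refine le_trans ?_ (le_sum_shortcutWeight_delivered (V := nodeSet n ω) hn0 hnext hR ha.le
    (fun t _ => hω'.hasCloserContacts hn0 (by linarith) hRn t)
    (fun t _ => hω'.card_near_le hn0 (by linarith) t)
    (fun t _ => hω'.hasAnnulusShortcuts hn0 hR hb0.le hb1 hba t) hK fun S hS => hS)
  have hcard := hω'.card_nodeSet_le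
  have hsqrt : √(n : ℝ) ≤ n := Real.sqrt_le_iff.2 ⟨hn'.le, by nlinarith⟩
  have hfinal : ((nodeSet n ω).card : ℝ) ^ 2 *
      (√n * ((1 + Real.exp (-(b / 50000))) / 2) ^ k) ≤ 16 / n := by
    -- At most (4n)² pairs, initial potential √n ≤ n, decay n⁻⁴.
    calc _ ≤ (4 * (n : ℝ)) ^ 2 * (n * ((n : ℝ) ^ 4)⁻¹) := by gcongr
      _ = 16 / n := by field_simp; norm_num
  linarith

theorem eventually_localRadius_le (hc : 0 ≤ c) : ∀ᶠ n : ℕ in atTop, localRadius c n ≤ √n := by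
  have h := (Real.isLittleO_log_id_atTop.comp_tendsto tendsto_natCast_atTop_atTop).bound
    (c := 1 / (c + 1)) (by positivity)
  filter_upwards [h] with n hn
  refine Real.sqrt_le_sqrt ?_
  simp only [Function.comp_apply, id_eq, Real.norm_eq_abs, Nat.abs_cast] at hn
  have h1 := (le_abs_self _).trans hn
  rw [div_mul_eq_mul_div, one_mul, le_div_iff₀ (by positivity)] at h1
  have := Real.log_natCast_nonneg n
  nlinarith

end Limit

end

end SmallWorld

theorem mainTheorem1 :
    ∃ c₀ : ℝ, 0 < c₀ ∧ ∀ c : ℝ, c₀ ≤ c → ∃ C : ℝ, 0 < C ∧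
      ∀ a : ℕ → ℝ,
        (∀ᶠ n : ℕ in atTop, ∀ x ∈ Set.Icc (0 : ℝ) √n ×ˢ Set.Icc (0 : ℝ) √n,
          SmallWorld.expectedShortcuts c n (a n) x = 1) →
      ∀ next : ℕ → SmallWorld.View → SmallWorld.Pt,
        (∀ n, SmallWorld.IsApproxGreedy n (next n)) →
        Tendsto (fun n : ℕ => SmallWorld.graphProb c n (a n) fun V S =>
            ∀ s ∈ V, ∀ t ∈ V,
              SmallWorld.DeliveredWithin c n (next n) V S s t (C * Real.log n ^ 2))
          atTop (𝓝 1) := by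
  refine ⟨1296, by norm_num, fun c hc => ⟨SmallWorld.hopConstant c, ?_, ?_⟩⟩
  · unfold SmallWorld.hopConstant; positivity
  intro a ha next hnext
  have hx : ∀ᶠ n : ℕ in atTop, SmallWorld.expectedShortcuts c n (a n) (0, 0) = 1 := by
    filter_upwards [ha] with n hn
    exact hn _ ⟨⟨le_rfl, Real.sqrt_nonneg _⟩, ⟨le_rfl, Real.sqrt_nonneg _⟩⟩
  have hlim : Tendsto (fun n : ℕ => ENNReal.ofReal (1 - 16 / (n : ℝ)) *
      (1 - ENNReal.ofReal (3 / (n : ℝ)))) atTop (𝓝 1) := by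
    have h16 : Tendsto (fun n : ℕ => ENNReal.ofReal (1 - 16 / (n : ℝ))) atTop (𝓝 1) := by
      have := ENNReal.tendsto_ofReal
        ((tendsto_const_div_atTop_nhds_zero_nat (16 : ℝ)).const_sub (1 : ℝ))
      simpa using this
    have h3 : Tendsto (fun n : ℕ => 1 - ENNReal.ofReal (3 / (n : ℝ))) atTop (𝓝 1) := by
      have h := ENNReal.tendsto_ofReal (tendsto_const_div_atTop_nhds_zero_nat (3 : ℝ))
      have := ENNReal.Tendsto.sub (tendsto_const_nhds (x := (1 : ℝ≥0∞))) h
        (Or.inl ENNReal.one_ne_top)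
      simpa using this
    have := ENNReal.Tendsto.mul h16 (Or.inl one_ne_zero) h3 (Or.inl one_ne_zero)
    simpa using this
  refine tendsto_of_tendsto_of_tendsto_of_le_of_le' hlim tendsto_const_nhds ?_ ?_
  · filter_upwards [hx, eventually_ge_atTop 81,
      SmallWorld.eventually_localRadius_le (c := c) (by linarith)] with n h1 h2 h3
    exact SmallWorld.le_graphProb_delivered (hnext n) h2 hc h3 h1
  · filter_upwards [hx] with n h1
    exact SmallWorld.graphProb_le_one (SmallWorld.pos_of_expectedShortcuts_eq_one h1).le _
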